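/- Let $\sigma,\alpha\in\mathbb R$ and, for $c>0$, let $F(s)=-cs+\frac{\sigma}{2}s^2+\frac{\alpha}{3}s^3$. For $\beta\ge 0$ consider the steady Gardner--Ostrovsky equation $$F(\phi)+\beta\phi_{xx}=-D^{-2}\phi+B_\phi, \qquad (\ast)$$ where $D^{-2}$ is the Fourier multiplier with symbol $k^{-2}$ ($k\in\mathbb Z\setminus\{0\}$) on functions of zero mean and $B_\phi\in\mathbb R$ is a constant of integration. A solution of $(\ast)$ is a continuous $2\pi$-periodic function $\phi:\mathbb R\to\mathbb R$ of zero mean that satisfies $(\ast)$ in the sense of distributions on $\mathbb T=\mathbb R/2\pi\mathbb Z$ for some $B_\phi$. For $1<a<2$ let $C^a_{0,\mathrm{even}}(\mathbb T)$ be the space of even $2\pi$-periodic functions of zero mean of class $C^{1,a-1}$, with norm $\sup|f|+\sup|f'|+\sup_{x\ne y}|f'(x)-f'(y)|/|x-y|^{a-1}$. Put $$\phi_*^{\pm}=-\frac{\sigma}{2\alpha}\pm\sqrt{\frac{\sigma^2}{4\alpha^2}+\frac{c}{\alpha}}\quad(\alpha\neq0),\qquad \phi_{*,0}=\frac{c}{\sigma}\quad(\alpha=0,\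 \sigma\ne0).$$ **Existence.** Let $\beta\in[0,1)$ and $a\in(1,2)$. There are $\varepsilon_0>0$ and a smooth curve $\varepsilon\mapsto(c(\varepsilon),\phi(\varepsilon))\in(0,\infty)\times C^a_{0,\mathrm{even}}(\mathbb T)$, $|\varepsilon|<\varepsilon_0$, with $c(0)=1-\beta$, $\phi(0)=0$ and $\phi'(0)\neq0$ (derivative in $\varepsilon$), such that $\phi(\varepsilon)$ is a solution of $(\ast)$ with $c=c(\varepsilon)$, and $\phi(\varepsilon)\ne0$ for $\varepsilon\neq0$. **The case $\beta>0$.** If $c>0$, $\beta>0$ and $\phi$ is a solution of $(\ast)$, then $\phi$ is $C^\infty$. If moreover $\phi$ has a single crest per period (there are $x_0<x_1<x_0+2\pi$ such that $\phi$ is non-decreasing on $[x_0,x_1]$ and non-increasing on $[x_1,x_0+2\pi]$), then $\phi$ is symmetric, i.e. $\phi(2\lambda-x)=\phi(x)$ for all $x$, for some $\lambda\in\mathbb R$. **The case $\beta=0$.** Let $c>0$ and let $\phi$ be a solution of $(\ast)$ with $\beta=0$. 1. $\phi$ is $C^\infty$ on every open set where $\sigma\phi+\alpha\phi^2<c$.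 In particular, $\phi$ is $C^\infty$ on $\mathbb R$ if $\alpha<-\frac{\sigma^2}{4c}$. 2. If $\phi$ has a local maximum or minimum (isolated or not) at a point $\bar x$ with $\sigma\phi(\bar x)+\alpha\phi(\bar x)^2=c$, then $\phi\notin C^1(\mathbb T)$. 3. Say that $\phi$ is critical at $x_0$ if one of the following holds, where $\max\phi$ and $\min\phi$ are understood to be attained at $x_0$: - $-\frac{\sigma^2}{4c}\le\alpha<0$, $\sigma>0$ and $\max\phi=\phi_*^-$; - $-\frac{\sigma^2}{4c}\le\alpha<0$, $\sigma<0$ and $\min\phi=\phi_*^+$; - $\alpha=0$, $\sigma>0$ and $\max\phi=\phi_{*,0}$; - $\alpha=0$, $\sigma<0$ and $\min\phi=\phi_{*,0}$; - $\alpha>0$ and either $\max\phi=\phi_*^+$ or $\min\phi=\phi_*^-$. If $\phi$ is critical at $x_0$, then $\phi\notin C^1(\mathbb T)$. More precisely: - if $\alpha>-\frac{\sigma^2}{4c}$, then $\phi$ is precisely Lipschitz continuous at $x_0$ ($|\phi(x)-\phi(x_0)|$ is bounded above and below by positive multiples of $|x-x_0|$ near $x_0$), the one-sided derivatives $\phi'(x_{0\pm})$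 exist and are the one-sided limits of $\phi'$ at $x_0$, and $$|\phi'(x_{0\pm})|^2=\frac{|\phi(x_0)|}{|\sigma+2\alpha\phi(x_0)|};$$ - if $\alpha=-\frac{\sigma^2}{4c}$, then $\phi$ is precisely $\frac23$-Hölder continuous at $x_0$ ($|\phi(x)-\phi(x_0)|$ is bounded above and below by positive multiples of $|x-x_0|^{2/3}$ near $x_0$), and $$\lim_{x\to x_0}\frac{|\phi(x)-\phi(x_0)|}{|x-x_0|^{2/3}}=\Big(\frac{3|\phi(x_0)|}{2|\alpha|}\Big)^{1/3}.$$ 4. If $\alpha>0$, then $\max\phi-\min\phi\le2\sqrt{\frac{\sigma^2}{4\alpha^2}+\frac c\alpha}$. If $-\frac{\sigma^2}{4c}<\alpha<0$, then $\phi\le\phi_*^-$ with $\phi_*^->0$ in case $\sigma>0$, and $\phi\ge\phi_*^+$ with $\phi_*^+<0$ in case $\sigma<0$. If $\alpha=0$, then $\phi\le\phi_{*,0}$ with $\phi_{*,0}>0$ in case $\sigma>0$, and $\phi\ge\phi_{*,0}$ with $\phi_{*,0}<0$ in case $\sigma<0$. -/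

import Mathlib

open Real Set Filter Topology
open scoped ContDiff

namespace GardnerOstrovsky

noncomputable section

/-! ### The even, mean-zero Hölder space on the torus -/

/-- The functions of class `C^{1,a-1}` on the torus `ℝ / 2πℤ` that are even and have zero mean.
For `1 < a < 2` this is the set underlying the space `C^a_{0,even}(𝕋)`. -/
def evenHolderSubmodule (a : ℝ) : Submodule ℝ (ℝ → ℝ) where
  carrier := {f | Function.Periodic f (2 * π) ∧ (∀ x, f (-x) = f x) ∧
    (∫ x in (-π)..π, f x) = 0 ∧ ContDiff ℝ 1 f ∧
    ∃ C : ℝ, ∀ x y, |deriv f x - deriv f y| ≤ C * |x - y| ^ (a - 1)}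
  add_mem' := by
    rintro f g ⟨pf, ef, mf, cf, C, hC⟩ ⟨pg, eg, mg, cg, D, hD⟩
    refine ⟨pf.add pg, fun x => by simp [ef x, eg x], ?_, cf.add cg, C + D, fun x y => ?_⟩
    · simp only [Pi.add_apply]
      rw [intervalIntegral.integral_add (cf.continuous.intervalIntegrable _ _)
        (cg.continuous.intervalIntegrable _ _), mf, mg, add_zero]
    · have h : ∀ z, deriv (f + g) z = deriv f z + deriv g z := fun z =>
        deriv_add (cf.differentiable one_ne_zero z) (cg.differentiable one_ne_zero z)
      rw [h, h, add_mul]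
      have e : deriv f x + deriv g x - (deriv f y + deriv g y)
        = (deriv f x - deriv f y) + (deriv g x - deriv g y) := by ring
      rw [e]
      exact (abs_add_le _ _).trans (add_le_add (hC x y) (hD x y))
  zero_mem' := by
    refine ⟨fun _ => rfl, fun _ => rfl, by simp, contDiff_const, 0, fun x y => ?_⟩
    have h : deriv (0 : ℝ → ℝ) = 0 := deriv_const' 0
    simp [h]
  smul_mem' := by
    rintro r f ⟨pf, ef, mf, cf, C, hC⟩
    refine ⟨fun x => by simp [pf x], fun x => by simp [ef x], ?_, cf.const_smul r, |r| * C,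
      fun x y => ?_⟩
    · simp only [Pi.smul_apply, smul_eq_mul]
      rw [intervalIntegral.integral_const_mul, mf, mul_zero]
    · have h : ∀ z, deriv (r • f) z = r * deriv f z := fun z =>
        deriv_const_smul r (cf.differentiable one_ne_zero z)
      rw [h, h, ← mul_sub, abs_mul, mul_assoc]
      exact mul_le_mul_of_nonneg_left (hC x y) (abs_nonneg r)

/-- The space `C^a_{0,even}(𝕋)`, `1 < a < 2`, which is normed below. -/
def EvenHolder (a : ℝ) : Type := ↥(evenHolderSubmodule a)

namespace EvenHolder

variable {a : ℝ}

instance : AddCommGroup (EvenHolder a) := inferInstanceAs (AddCommGroup ↥(evenHolderSubmodule a))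

instance : Module ℝ (EvenHolder a) := inferInstanceAs (Module ℝ ↥(evenHolderSubmodule a))

/-- The function on `ℝ` underlying an element of `C^a_{0,even}(𝕋)`. -/
def toFun (f : EvenHolder a) : ℝ → ℝ := f.1

/-- The Hölder norm `sup |f| + sup |f'| + sup_{x ≠ y} |f' x - f' y| / |x - y| ^ (a - 1)`.
(The quotient is `0` for `x = y`.) -/
instance : Norm (EvenHolder a) where
  norm f := (⨆ x : ℝ, |f.toFun x|) + (⨆ x : ℝ, |deriv f.toFun x|)
    + ⨆ p : ℝ × ℝ, |(deriv f.toFun p.1 - deriv f.toFun p.2) / |p.1 - p.2| ^ (a - 1)|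

theorem norm_def (f : EvenHolder a) : ‖f‖ = (⨆ x : ℝ, |f.toFun x|) + (⨆ x : ℝ, |deriv f.toFun x|)
    + ⨆ p : ℝ × ℝ, |(deriv f.toFun p.1 - deriv f.toFun p.2) / |p.1 - p.2| ^ (a - 1)| := rfl

theorem toFun_add (f g : EvenHolder a) : (f + g).toFun = f.toFun + g.toFun := rfl

theorem toFun_smul (r : ℝ) (f : EvenHolder a) : (r • f).toFun = r • f.toFun := rfl

theorem contDiff (f : EvenHolder a) : ContDiff ℝ 1 f.toFun := f.2.2.2.2.1

theorem deriv_add (f g : EvenHolder a) (x : ℝ) :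
    deriv (f + g).toFun x = deriv f.toFun x + deriv g.toFun x :=
  _root_.deriv_add (f.contDiff.differentiable one_ne_zero x)
    (g.contDiff.differentiable one_ne_zero x)

theorem deriv_smul (r : ℝ) (f : EvenHolder a) (x : ℝ) :
    deriv (r • f).toFun x = r * deriv f.toFun x :=
  deriv_const_smul r (f.contDiff.differentiable one_ne_zero x)

theorem bdd_of_periodic {g : ℝ → ℝ} (hg : Continuous g) (hp : Function.Periodic g (2 * π)) :
    BddAbove (range fun x => |g x|) := by
  obtain ⟨C, hC⟩ := (isCompact_Icc (a := (0 : ℝ)) (b := 0 + 2 * π)).bddAbove_image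
    (hg.abs.continuousOn)
  refine ⟨C, ?_⟩
  rintro _ ⟨x, rfl⟩
  obtain ⟨y, hy, hxy⟩ := hp.exists_mem_Ico₀ two_pi_pos x
  simp only [hxy]
  exact hC ⟨y, ⟨hy.1, by linarith [hy.2]⟩, rfl⟩

theorem bdd_fun (f : EvenHolder a) : BddAbove (range fun x => |f.toFun x|) :=
  bdd_of_periodic f.contDiff.continuous f.2.1

theorem bdd_deriv (f : EvenHolder a) : BddAbove (range fun x => |deriv f.toFun x|) := by
  refine bdd_of_periodic (f.contDiff.continuous_deriv le_rfl) fun x => ?_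
  have h : (fun y => f.toFun (y + 2 * π)) = f.toFun := funext f.2.1
  rw [← deriv_comp_add_const, h]

theorem bdd_quot (f : EvenHolder a) : BddAbove (range fun p : ℝ × ℝ =>
    |(deriv f.toFun p.1 - deriv f.toFun p.2) / |p.1 - p.2| ^ (a - 1)|) := by
  obtain ⟨C, hC⟩ := f.2.2.2.2.2
  refine ⟨max C 0, ?_⟩
  rintro _ ⟨⟨x, y⟩, rfl⟩
  by_cases h : x = y
  · simp [h]
  · have hpos : 0 < |x - y| ^ (a - 1) := rpow_pos_of_pos (abs_pos.2 (sub_ne_zero.2 h)) _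
    simp only [abs_div, abs_of_pos hpos]
    exact (div_le_iff₀ hpos).2 ((hC x y).trans
      (mul_le_mul_of_nonneg_right (le_max_left _ _) hpos.le))

theorem iSup_abs_add_le {ι : Type} [Nonempty ι] {u v w : ι → ℝ} (h : ∀ i, w i = u i + v i)
    (hu : BddAbove (range fun i => |u i|)) (hv : BddAbove (range fun i => |v i|)) :
    (⨆ i, |w i|) ≤ (⨆ i, |u i|) + ⨆ i, |v i| :=
  ciSup_le fun i => by
    rw [h]
    exact (abs_add_le _ _).trans (add_le_add (le_ciSup hu i) (le_ciSup hv i))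

theorem iSup_abs_smul {ι : Type} {u w : ι → ℝ} (r : ℝ) (h : ∀ i, w i = r * u i) :
    (⨆ i, |w i|) = |r| * ⨆ i, |u i| := by
  rw [Real.mul_iSup_of_nonneg (abs_nonneg r)]
  simp only [h, abs_mul]

theorem normCore : NormedSpace.Core ℝ (EvenHolder a) where
  norm_nonneg f := by
    rw [norm_def]
    have h1 := Real.iSup_nonneg fun x => abs_nonneg (f.toFun x)
    have h2 := Real.iSup_nonneg fun x => abs_nonneg (deriv f.toFun x)
    have h3 := Real.iSup_nonneg fun p : ℝ × ℝ =>
      abs_nonneg ((deriv f.toFun p.1 - deriv f.toFun p.2) / |p.1 - p.2| ^ (a - 1))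
    linarith
  norm_smul r f := by
    rw [norm_def, norm_def, iSup_abs_smul (u := f.toFun) r fun x => by rw [toFun_smul]; rfl,
      iSup_abs_smul (u := deriv f.toFun) r (deriv_smul r f),
      iSup_abs_smul (u := fun p : ℝ × ℝ =>
        (deriv f.toFun p.1 - deriv f.toFun p.2) / |p.1 - p.2| ^ (a - 1)) r
        fun p => by rw [deriv_smul, deriv_smul]; ring, Real.norm_eq_abs]
    ring
  norm_triangle f g := by
    rw [norm_def, norm_def, norm_def]
    have h1 := iSup_abs_add_le (u := f.toFun) (v := g.toFun) (w := (f + g).toFun) (fun _ => rfl)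
      f.bdd_fun g.bdd_fun
    have h2 := iSup_abs_add_le (deriv_add f g) f.bdd_deriv g.bdd_deriv
    have h3 := iSup_abs_add_le (w := fun p : ℝ × ℝ =>
        (deriv (f + g).toFun p.1 - deriv (f + g).toFun p.2) / |p.1 - p.2| ^ (a - 1))
      (fun p => by rw [deriv_add, deriv_add]; ring) f.bdd_quot g.bdd_quot
    linarith
  norm_eq_zero_iff f := by
    constructor
    · intro h
      rw [norm_def] at h
      have h1 := Real.iSup_nonneg fun x => abs_nonneg (f.toFun x)
      have h2 := Real.iSup_nonneg fun x => abs_nonneg (deriv f.toFun x)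
      have h3 := Real.iSup_nonneg fun p : ℝ × ℝ =>
        abs_nonneg ((deriv f.toFun p.1 - deriv f.toFun p.2) / |p.1 - p.2| ^ (a - 1))
      refine Subtype.ext (funext fun x => ?_)
      have h4 : |f.toFun x| ≤ 0 := (le_ciSup f.bdd_fun x).trans (by linarith)
      exact abs_nonpos_iff.1 h4
    · rintro rfl
      have h : (0 : EvenHolder a).toFun = fun _ => 0 := rfl
      simp [norm_def, h]

instance : NormedAddCommGroup (EvenHolder a) := NormedAddCommGroup.ofCore normCore

instance : NormedSpace ℝ (EvenHolder a) := NormedSpace.ofCore normCore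

end EvenHolder

/-! ### The steady equation -/

/-- The nonlinearity `F(s) = -c s + (σ/2) s² + (α/3) s³`. -/
def F (c σ α s : ℝ) : ℝ := -c * s + σ / 2 * s ^ 2 + α / 3 * s ^ 3

/-- The Fourier coefficient `(1/2π) ∫_{-π}^{π} φ(x) e^{-ikx} dx`. -/
def fourierHat (φ : ℝ → ℝ) (k : ℤ) : ℂ :=
  fourierCoeffOn (neg_lt_self pi_pos) (fun x => (φ x : ℂ)) k

/-- The Fourier multiplier `D⁻²` with symbol `1/k²`, acting on functions of zero mean:
`(D⁻² φ)(x) = ∑_{k ≠ 0} k⁻² φ̂(k) e^{ikx}`. (The term `k = 0` vanishes since `0⁻¹ = 0`.) -/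
def invDSq (φ : ℝ → ℝ) (x : ℝ) : ℝ :=
  (∑' k : ℤ, ((k : ℂ) ^ 2)⁻¹ * fourierHat φ k * Complex.exp (Complex.I * k * x)).re

/-- `φ` is a continuous, `2π`-periodic solution, with zero mean, of
`F(φ) + β φ_xx = - D⁻² φ + B` for some constant `B` of integration. As `φ` is only assumed to be
continuous, the equation is understood in the sense of distributions on the torus. -/
structure IsSolution (c β σ α : ℝ) (φ : ℝ → ℝ) : Prop where
  continuous : Continuous φ
  periodic : Function.Periodic φ (2 * π)
  mean_zero : (∫ x in (-π)..π, φ x) = 0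
  equation : ∃ B : ℝ, ∀ ψ : ℝ → ℝ, ContDiff ℝ ∞ ψ → Function.Periodic ψ (2 * π) →
    (∫ x in (-π)..π, (F c σ α (φ x) * ψ x + β * (φ x * iteratedDeriv 2 ψ x)))
      = ∫ x in (-π)..π, (-invDSq φ x + B) * ψ x

/-! ### Qualitative properties of wave profiles -/

/-- A single crest per period: over some period, `φ` increases from a trough to a crest and then
decreases to the next trough. -/
def SingleCrest (φ : ℝ → ℝ) : Prop :=
  ∃ x₀ x₁ : ℝ, x₀ < x₁ ∧ x₁ < x₀ + 2 * π ∧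
    MonotoneOn φ (Icc x₀ x₁) ∧ AntitoneOn φ (Icc x₁ (x₀ + 2 * π))

/-- Symmetry of the profile about some vertical axis. -/
def Symmetric (φ : ℝ → ℝ) : Prop := ∃ l : ℝ, ∀ x, φ (2 * l - x) = φ x

/-- `φ` is precisely `s`-Hölder continuous at `x₀` (precisely Lipschitz if `s = 1`):
`|φ x - φ x₀|` is bounded from above and below by multiples of `|x - x₀| ^ s` near `x₀`. -/
def PreciselyHolderAt (s : ℝ) (φ : ℝ → ℝ) (x₀ : ℝ) : Prop :=
  ∃ m M : ℝ, 0 < m ∧ 0 < M ∧ ∀ᶠ x in 𝓝 x₀,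
    m * |x - x₀| ^ s ≤ |φ x - φ x₀| ∧ |φ x - φ x₀| ≤ M * |x - x₀| ^ s

/-! ### The critical values -/

/-- `φ_*^+`, for `α ≠ 0`. -/
def critPlus (c σ α : ℝ) : ℝ := -σ / (2 * α) + √(σ ^ 2 / (4 * α ^ 2) + c / α)

/-- `φ_*^-`, for `α ≠ 0`. -/
def critMinus (c σ α : ℝ) : ℝ := -σ / (2 * α) - √(σ ^ 2 / (4 * α ^ 2) + c / α)

/-- `φ_{*,0}`, for `α = 0` and `σ ≠ 0`. -/
def critZero (c σ : ℝ) : ℝ := c / σ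

/-- `φ` attains its maximum at `x₀`, with value `v`. -/
def MaxAt (φ : ℝ → ℝ) (x₀ v : ℝ) : Prop := (∀ x, φ x ≤ φ x₀) ∧ φ x₀ = v

/-- `φ` attains its minimum at `x₀`, with value `v`. -/
def MinAt (φ : ℝ → ℝ) (x₀ v : ℝ) : Prop := (∀ x, φ x₀ ≤ φ x) ∧ φ x₀ = v

/-- At `x₀`, the profile attains the critical extremal value tabulated according to the signs of
`σ` and `α`. -/
def AttainsCritical (c σ α : ℝ) (φ : ℝ → ℝ) (x₀ : ℝ) : Prop :=
  (-(σ ^ 2 / (4 * c)) ≤ α ∧ α < 0 ∧ 0 < σ ∧ MaxAt φ x₀ (critMinus c σ α)) ∨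
  (-(σ ^ 2 / (4 * c)) ≤ α ∧ α < 0 ∧ σ < 0 ∧ MinAt φ x₀ (critPlus c σ α)) ∨
  (α = 0 ∧ 0 < σ ∧ MaxAt φ x₀ (critZero c σ)) ∨
  (α = 0 ∧ σ < 0 ∧ MinAt φ x₀ (critZero c σ)) ∨
  (0 < α ∧ (MaxAt φ x₀ (critPlus c σ α) ∨ MinAt φ x₀ (critMinus c σ α)))

end

end GardnerOstrovsky

/-!
The operator `D⁻²` inverts `-d²/dx²`, so a solution `φ` has a periodic potential `v` with
`v'' = -φ`. Testing the equation with `cos (k x)` and `sin (k x)` shows that it holds in the local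
form `β φ'' + F(φ) + v = B` (`IsSolution.exists_potential`), and everything except existence is a
matter of ordinary differential equations.

*The case `β = 0`.* Here `F(φ)` is twice differentiable with `F(φ)'' = φ`, even where `φ` is not
smooth. Where `F'(φ) = σ φ + α φ² - c` does not vanish, `F` is locally invertible and `φ` is
smooth by bootstrapping (`contDiffOn_of_noncritical`). At an extremum `x₀` of `φ` with critical
value `s₀`, `F(φ)' = 0`, and comparing `F(φ) - F(s₀) ∼ s₀ (x - x₀)² / 2` with the Taylor expansion
of `F` at `s₀` gives the exact behaviour of `φ - s₀`: a corner if `F''(s₀) ≠ 0`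
(`corner_of_nondegenerate`), a cusp of exponent `2/3` if `F''(s₀) = 0` (`cusp_of_degenerate`), and
in no case differentiability. If `s₀ > 0` is a nondegenerate critical value, then `F(φ)'` vanishes
wherever `φ = s₀`, whereas its derivative `φ` is positive on `{φ > s₀}`; hence `φ ≤ s₀`
(`le_of_deriv_eq_zero`).

*The case `β > 0`.* Smoothness is again a bootstrap. Symmetry is proved by moving planes. The
difference `h` of `φ` and its reflection about an axis satisfies `β h'' + q h = -g` with
`-g'' = h`, and both `h` and `g` vanish at the two ends of a half period. If `h ≥ 0` there, then
`g > 0` by concavity, whence `h > 0` with nonzero slopes at the ends, or `h = 0`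
(`IsWave.strict_of_dominates`); so the axis can be moved until `h = 0`
(`IsWave.symmetric_of_dominates`). A first axis with `h ≥ 0` is found by the intermediate value
theorem, for which a single crest is needed (`IsWave.symmetric_of_singleCrest`).

*Existence.* The profile is written as `φ = ε (cos x / 4 + …)` with a cosine series whose
coefficients belong to a weighted `ℓ¹` space. The functions with such coefficients form a Banach
algebra, which embeds into `C²`, hence into the Hölder space (`Coeff.toHolder`). Since the
linearization at the speed `1 - β` is a Fourier multiplier that vanishes on the first mode only,
the equation divided by `ε`, in terms of the image of the profile under the linearization and in
which the deviation of the speed from `1 - β` takes the place of the missing first mode, has the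
identity as its derivative at the origin, and the implicit function theorem applies
(`Coeff.exists_branch`).
-/

namespace GardnerOstrovsky

noncomputable section

/-! ### Fourier series of periodic functions and the operator `D⁻²` -/

theorem fourierHat_eq_integral (h : ℝ → ℝ) (k : ℤ) :
    fourierHat h k
      = (1 / (2 * π) : ℝ) * ∫ x in (-π)..π, Complex.exp (-(Complex.I * k * x)) * h x := by
  have e : π - -π = 2 * π := by ring
  rw [fourierHat, fourierCoeffOn_eq_integral, Complex.real_smul, e]
  congr 1
  refine intervalIntegral.integral_congr fun x _ => ?_
  simp only [fourier_coe_apply, smul_eq_mul]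
  congr 2
  have : (π : ℂ) ≠ 0 := by exact_mod_cast pi_ne_zero
  push_cast
  field_simp

theorem fourierHat_eq_cos_sin {h : ℝ → ℝ} (hc : Continuous h) (k : ℤ) :
    fourierHat h k = (1 / (2 * π) : ℝ) * (((∫ x in (-π)..π, h x * cos (k * x) : ℝ) : ℂ)
      - Complex.I * ((∫ x in (-π)..π, h x * sin (k * x) : ℝ) : ℂ)) := by
  rw [fourierHat_eq_integral]
  congr 1
  rw [← intervalIntegral.integral_ofReal, ← intervalIntegral.integral_ofReal,
    ← intervalIntegral.integral_const_mul, ← intervalIntegral.integral_sub]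
  · refine intervalIntegral.integral_congr fun x _ => ?_
    have : -(Complex.I * k * x) = ((-(k * x) : ℝ) : ℂ) * Complex.I := by push_cast; ring
    simp only [this, Complex.exp_mul_I]
    push_cast
    simp only [Complex.cos_neg, Complex.sin_neg]
    ring
  · exact Continuous.intervalIntegrable (by fun_prop) _ _
  · exact Continuous.intervalIntegrable (by fun_prop) _ _

theorem fourierHat_zero (h : ℝ → ℝ) :
    fourierHat h 0 = (1 / (2 * π) : ℝ) * ((∫ x in (-π)..π, h x : ℝ) : ℂ) := by
  rw [fourierHat_eq_integral, ← intervalIntegral.integral_ofReal]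
  simp

/-- A continuous periodic function is the sum of its Fourier series if the latter converges
absolutely. -/
theorem hasSum_fourierHat {h : ℝ → ℝ} (hc : Continuous h) (hp : Function.Periodic h (2 * π))
    (hs : Summable (fourierHat h)) (x : ℝ) :
    HasSum (fun k : ℤ => fourierHat h k * Complex.exp (Complex.I * k * x)) (h x : ℂ) := by
  have e : π - -π = 2 * π := by ring
  have : Fact (0 < π - -π) := ⟨by linarith [pi_pos]⟩
  have hp' : Function.Periodic (fun x => (h x : ℂ)) (π - -π) := fun y => by simp [e, hp y]
  let H : C(AddCircle (π - -π), ℂ) := ⟨hp'.lift, by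
    rw [(QuotientAddGroup.isQuotientMap_mk _).continuous_iff]
    exact Complex.continuous_ofReal.comp hc⟩
  have hH : fourierCoeff H = fourierHat h := by
    funext k
    rw [fourierCoeff_eq_intervalIntegral _ k (-π), fourierHat, fourierCoeffOn_eq_integral]
    have : -π + (π - -π) = π := by ring
    rw [this]
    rfl
  have := has_pointwise_sum_fourier_series_of_summable (f := H) (by rwa [hH]) (x : AddCircle _)
  rw [hH] at this
  convert! this using 2 with k
  rw [fourier_coe_apply, smul_eq_mul]
  congr 2
  have : (π : ℂ) ≠ 0 := by exact_mod_cast pi_ne_zero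
  push_cast
  field_simp
  ring

theorem fourierHat_deriv {f f' : ℝ → ℝ} (hf : ∀ x, HasDerivAt f (f' x) x) (hc : Continuous f')
    (hp : Function.Periodic f (2 * π)) (k : ℤ) :
    fourierHat f' k = Complex.I * k * fourierHat f k := by
  have hper : f π = f (-π) := by rw [← hp (-π)]; congr 1; ring
  rcases eq_or_ne k 0 with rfl | hk
  · rw [fourierHat_zero, intervalIntegral.integral_eq_sub_of_hasDerivAt (fun x _ => hf x)
      (hc.intervalIntegrable _ _), hper]
    simp
  · have := fourierCoeffOn_of_hasDerivAt (neg_lt_self pi_pos) (f := fun x => (f x : ℂ))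
      (f' := fun x => (f' x : ℂ)) hk (fun x _ => (hf x).ofReal_comp)
      ((Complex.continuous_ofReal.comp hc).intervalIntegrable _ _)
    rw [fourierHat, fourierHat, this, hper]
    have : (π : ℂ) ≠ 0 := by exact_mod_cast pi_ne_zero
    have : (k : ℂ) ≠ 0 := by exact_mod_cast hk
    have := Complex.I_ne_zero
    push_cast
    field_simp
    ring

/-- A continuous periodic function which is orthogonal to the second derivatives of all smooth
periodic functions is constant. -/
theorem eq_const_of_forall_integral_eq_zero {h : ℝ → ℝ} (hc : Continuous h)
    (hp : Function.Periodic h (2 * π))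
    (ht : ∀ ψ : ℝ → ℝ, ContDiff ℝ ∞ ψ → Function.Periodic ψ (2 * π) →
      ∫ x in (-π)..π, h x * iteratedDeriv 2 ψ x = 0) (x : ℝ) : h x = h 0 := by
  have hz : ∀ k : ℤ, k ≠ 0 → fourierHat h k = 0 := by
    intro k hk
    have hk' : (k : ℝ) ^ 2 ≠ 0 := by positivity
    have d1 : ∀ x, HasDerivAt (fun x : ℝ => cos (k * x)) (-(k * sin (k * x))) x := fun x => by
      have := ((hasDerivAt_id x).const_mul (k : ℝ)).cos
      simpa [mul_comm] using this
    have d2 : ∀ x, HasDerivAt (fun x : ℝ => sin (k * x)) (k * cos (k * x)) x := fun x => by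
      have := ((hasDerivAt_id x).const_mul (k : ℝ)).sin
      simpa [mul_comm] using this
    have i1 : ∀ x, iteratedDeriv 2 (fun x : ℝ => cos (k * x)) x = -(k : ℝ) ^ 2 * cos (k * x) := by
      intro x
      rw [iteratedDeriv_succ, iteratedDeriv_one, funext fun x => (d1 x).deriv,
        ((d2 x).const_mul (k : ℝ)).fun_neg.deriv]
      ring
    have i2 : ∀ x, iteratedDeriv 2 (fun x : ℝ => sin (k * x)) x = -(k : ℝ) ^ 2 * sin (k * x) := by
      intro x
      rw [iteratedDeriv_succ, iteratedDeriv_one, funext fun x => (d2 x).deriv,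
        ((d1 x).const_mul (k : ℝ)).deriv]
      ring
    have p : ∀ x : ℝ, (k : ℝ) * (x + 2 * π) = k * x + k * (2 * π) := fun x => by ring
    have e1 := ht (fun x => cos (k * x)) (by fun_prop)
      (fun x => by simp only [p, cos_add_int_mul_two_pi])
    have e2 := ht (fun x => sin (k * x)) (by fun_prop)
      (fun x => by simp only [p, sin_add_int_mul_two_pi])
    simp only [i1, i2, mul_left_comm (h _), intervalIntegral.integral_const_mul, mul_eq_zero,
      neg_eq_zero, hk', false_or] at e1 e2
    rw [fourierHat_eq_cos_sin hc, e1, e2]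
    simp
  have hs : ∀ x : ℝ, h x = fourierHat h 0 := by
    intro x
    have hsum := hasSum_fourierHat hc hp
      (summable_of_ne_finset_zero (s := {0}) fun k hk => hz k (by simpa using hk)) x
    have := hsum.unique (hasSum_single 0 fun k hk => by rw [hz k hk, zero_mul])
    simpa using this
  exact_mod_cast (hs x).trans (hs 0).symm

/-- A continuous periodic function of zero mean has a periodic primitive of zero mean. -/
theorem exists_periodic_primitive {f : ℝ → ℝ} (hc : Continuous f)
    (hp : Function.Periodic f (2 * π)) (hm : ∫ x in (-π)..π, f x = 0) :
    ∃ g : ℝ → ℝ, (∀ x, HasDerivAt g (f x) x) ∧ Function.Periodic g (2 * π) ∧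
      ∫ x in (-π)..π, g x = 0 := by
  let G : ℝ → ℝ := fun x => ∫ t in (0 : ℝ)..x, f t
  have hG : ∀ x, HasDerivAt G (f x) x := fun x =>
    intervalIntegral.integral_hasDerivAt_right (hc.intervalIntegrable _ _)
      hc.stronglyMeasurable.stronglyMeasurableAtFilter hc.continuousAt
  have hGc : Continuous G := continuous_iff_continuousAt.2 fun x => (hG x).continuousAt
  refine ⟨fun x => G x - (2 * π)⁻¹ * ∫ t in (-π)..π, G t, fun x => (hG x).sub_const _,
    fun x => ?_, ?_⟩
  · have h1 : G (x + 2 * π) - G x = ∫ t in x..(x + 2 * π), f t :=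
      intervalIntegral.integral_interval_sub_left (hc.intervalIntegrable _ _)
        (hc.intervalIntegrable _ _)
    have h2 : ∫ t in x..(x + 2 * π), f t = ∫ t in (-π)..(-π + 2 * π), f t :=
      hp.intervalIntegral_add_eq x (-π)
    have h3 : -π + 2 * π = π := by ring
    rw [h2, h3, hm] at h1
    simp only [sub_eq_zero.1 h1]
  · rw [intervalIntegral.integral_sub (hGc.intervalIntegrable _ _)
      (continuous_const.intervalIntegrable _ _), intervalIntegral.integral_const, smul_eq_mul]
    have := pi_pos
    field_simp
    ring

/-- On functions of zero mean, `D⁻²` inverts `-d²/dx²`. -/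
theorem invDSq_eq {φ V V' : ℝ → ℝ} (hφ : Continuous φ) (hV : ∀ x, HasDerivAt V (V' x) x)
    (hV' : ∀ x, HasDerivAt V' (-φ x) x) (pV : Function.Periodic V (2 * π))
    (pV' : Function.Periodic V' (2 * π)) (hm : ∫ x in (-π)..π, V x = 0) (x : ℝ) :
    invDSq φ x = V x := by
  have cV : Continuous V := continuous_iff_continuousAt.2 fun x => (hV x).continuousAt
  have cV' : Continuous V' := continuous_iff_continuousAt.2 fun x => (hV' x).continuousAt
  have neg : ∀ k, fourierHat (fun x => -φ x) k = -fourierHat φ k := fun k => by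
    simp [fourierHat_eq_integral]
  have hk : ∀ k : ℤ, fourierHat φ k = k ^ 2 * fourierHat V k := fun k => by
    have h1 := fourierHat_deriv hV' hφ.neg pV' k
    rw [neg, fourierHat_deriv hV cV' pV k] at h1
    linear_combination (-1 : ℂ) * h1 - ((k : ℂ) ^ 2 * fourierHat V k) * Complex.I_sq
  have hcoef : ∀ k : ℤ, ((k : ℂ) ^ 2)⁻¹ * fourierHat φ k = fourierHat V k := fun k => by
    rcases eq_or_ne k 0 with rfl | h0
    · rw [fourierHat_zero V, hm]
      simp
    · have : (k : ℂ) ≠ 0 := by exact_mod_cast h0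
      rw [hk]
      field_simp
  have hb : ∃ C : ℝ, ∀ k : ℤ, ‖fourierHat φ k‖ ≤ C := by
    refine ⟨(1 / (2 * π)) * ∫ x in (-π)..π, |φ x|, fun k => ?_⟩
    rw [fourierHat_eq_integral, norm_mul, Complex.norm_real, Real.norm_eq_abs,
      abs_of_nonneg (by positivity)]
    refine mul_le_mul_of_nonneg_left ?_ (by positivity)
    refine intervalIntegral.norm_integral_le_of_norm_le (by linarith [pi_pos]) ?_
      (hφ.abs.intervalIntegrable _ _)
    refine Eventually.of_forall fun x _ => ?_
    rw [norm_mul, Complex.norm_real, Real.norm_eq_abs]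
    have : -(Complex.I * k * x) = ((-(k * x) : ℝ) : ℂ) * Complex.I := by push_cast; ring
    rw [this, Complex.norm_exp_ofReal_mul_I, one_mul]
  obtain ⟨C, hC⟩ := hb
  have hs : Summable (fourierHat V) := by
    have h2 : Summable fun k : ℤ => C * ((1 : ℝ) / (k : ℝ) ^ 2) :=
      (Real.summable_one_div_int_pow.2 one_lt_two).mul_left C
    refine Summable.of_norm_bounded h2 fun k => ?_
    rw [← hcoef, norm_mul, norm_inv, norm_pow, mul_comm]
    have : ‖(k : ℂ)‖ ^ 2 = (k : ℝ) ^ 2 := by rw [Complex.norm_intCast, sq_abs]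
    rw [this, one_div]
    exact mul_le_mul_of_nonneg_right (hC k) (by positivity)
  have := (hasSum_fourierHat cV pV hs x).tsum_eq
  rw [invDSq]
  simp only [hcoef, this, Complex.ofReal_re]

/-- Integration by parts, twice, over a period. -/
theorem integral_deriv_deriv_mul {Q Q' R ψ : ℝ → ℝ} (hQ : ∀ x, HasDerivAt Q (Q' x) x)
    (hQ' : ∀ x, HasDerivAt Q' (R x) x) (hR : Continuous R) (pQ : Function.Periodic Q (2 * π))
    (pQ' : Function.Periodic Q' (2 * π)) (hψ : ContDiff ℝ ∞ ψ)
    (pψ : Function.Periodic ψ (2 * π)) :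
    ∫ x in (-π)..π, R x * ψ x = ∫ x in (-π)..π, Q x * iteratedDeriv 2 ψ x := by
  have per : ∀ {f : ℝ → ℝ}, Function.Periodic f (2 * π) → f π = f (-π) := fun {f} hf => by
    rw [← hf (-π)]; congr 1; ring
  have cQ' : Continuous Q' := continuous_iff_continuousAt.2 fun x => (hQ' x).continuousAt
  have dψ : ∀ x, HasDerivAt ψ (deriv ψ x) x := fun x =>
    (hψ.differentiable (by simp) x).hasDerivAt
  have sψ' : ContDiff ℝ ∞ (deriv ψ) := hψ.iterate_deriv 1
  have sψ'' : ContDiff ℝ ∞ (deriv (deriv ψ)) := hψ.iterate_deriv 2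
  have dψ' : ∀ x, HasDerivAt (deriv ψ) (deriv (deriv ψ) x) x := fun x =>
    (sψ'.differentiable (by simp) x).hasDerivAt
  have pψ' : Function.Periodic (deriv ψ) (2 * π) := fun x => by
    have h : (fun y => ψ (y + 2 * π)) = ψ := funext pψ
    rw [← deriv_comp_add_const, h]
  have h1 := intervalIntegral.integral_mul_deriv_eq_deriv_mul (a := -π) (b := π)
    (fun x _ => dψ x) (fun x _ => hQ' x) (sψ'.continuous.intervalIntegrable _ _)
    (hR.intervalIntegrable _ _)
  have h2 := intervalIntegral.integral_mul_deriv_eq_deriv_mul (a := -π) (b := π)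
    (fun x _ => dψ' x) (fun x _ => hQ x) (sψ''.continuous.intervalIntegrable _ _)
    (cQ'.intervalIntegrable _ _)
  rw [per pψ, per pQ'] at h1
  rw [per pψ', per pQ] at h2
  have e : iteratedDeriv 2 ψ = deriv (deriv ψ) := by
    rw [iteratedDeriv_succ, iteratedDeriv_one]
  simp only [e, mul_comm (R _), mul_comm (Q _)]
  linarith

theorem continuous_F (c σ α : ℝ) : Continuous (F c σ α) := by unfold F; fun_prop

/-- The local form of the steady equation: with a periodic potential `v`, `v'' = -φ`, the equation
reads `β φ'' + F(φ) + v = B`. This is expressed by a periodic function `Q` with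
`Q'' = F(φ) + v - B` and `Q + β φ` constant. -/
theorem IsSolution.exists_potential {c β σ α : ℝ} {φ : ℝ → ℝ} (h : IsSolution c β σ α φ) :
    ∃ (v v' Q Q' : ℝ → ℝ) (B K : ℝ), (∀ x, HasDerivAt v (v' x) x) ∧
      (∀ x, HasDerivAt v' (-φ x) x) ∧ Function.Periodic v (2 * π) ∧
      (∀ x, HasDerivAt Q (Q' x) x) ∧ (∀ x, HasDerivAt Q' (F c σ α (φ x) + v x - B) x) ∧
      ∀ x, Q x = K - β * φ x := by
  have hφ := h.continuous
  obtain ⟨v', hv', pv', mv'⟩ := exists_periodic_primitive hφ.neg (fun x => by simp [h.periodic x])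
    (by simp [h.mean_zero])
  have cv' : Continuous v' := continuous_iff_continuousAt.2 fun x => (hv' x).continuousAt
  obtain ⟨v, hv, pv, mv⟩ := exists_periodic_primitive cv' pv' mv'
  have cv : Continuous v := continuous_iff_continuousAt.2 fun x => (hv x).continuousAt
  obtain ⟨B, hB⟩ := h.equation
  simp only [invDSq_eq hφ hv hv' pv pv' mv] at hB
  have cF : Continuous fun x => F c σ α (φ x) := (continuous_F c σ α).comp hφ
  have cR : Continuous fun x => F c σ α (φ x) + v x - B := by fun_prop
  have weak : ∀ ψ : ℝ → ℝ, ContDiff ℝ ∞ ψ → Function.Periodic ψ (2 * π) →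
      (∫ x in (-π)..π, (F c σ α (φ x) + v x - B) * ψ x)
        = -∫ x in (-π)..π, β * φ x * iteratedDeriv 2 ψ x := by
    intro ψ hψ pψ
    have c0 := hψ.continuous
    have c2 : Continuous (iteratedDeriv 2 ψ) := hψ.continuous_iteratedDeriv 2
      (WithTop.coe_le_coe.2 le_top)
    have := hB ψ hψ pψ
    rw [eq_neg_iff_add_eq_zero, ← intervalIntegral.integral_add
      (Continuous.intervalIntegrable (by fun_prop) _ _)
      (Continuous.intervalIntegrable (by fun_prop) _ _), ← sub_eq_zero.2 this,
      ← intervalIntegral.integral_sub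
      (Continuous.intervalIntegrable (by fun_prop) _ _)
      (Continuous.intervalIntegrable (by fun_prop) _ _)]
    refine intervalIntegral.integral_congr fun x _ => ?_
    ring
  -- The test function `1` shows that `F(φ) + v - B` has zero mean, so that `Q` exists.
  have mR := weak (fun _ => 1) contDiff_const (fun _ => rfl)
  simp [iteratedDeriv_const] at mR
  obtain ⟨Q', hQ', pQ', mQ'⟩ := exists_periodic_primitive cR
    (fun x => by simp [h.periodic x, pv x]) mR
  have cQ' : Continuous Q' := continuous_iff_continuousAt.2 fun x => (hQ' x).continuousAt
  obtain ⟨Q, hQ, pQ, -⟩ := exists_periodic_primitive cQ' pQ' mQ'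
  have cQ : Continuous Q := continuous_iff_continuousAt.2 fun x => (hQ x).continuousAt
  refine ⟨v, v', Q, Q', B, Q 0 + β * φ 0, hv, hv', pv, hQ, hQ', fun x => ?_⟩
  have := eq_const_of_forall_integral_eq_zero (h := fun x => Q x + β * φ x) (by fun_prop)
    (fun x => by simp [pQ x, h.periodic x]) (fun ψ hψ pψ => ?_) x
  · linarith
  · have c2 : Continuous (iteratedDeriv 2 ψ) := hψ.continuous_iteratedDeriv 2
      (WithTop.coe_le_coe.2 le_top)
    have e1 := weak ψ hψ pψ
    rw [integral_deriv_deriv_mul hQ hQ' cR pQ pQ' hψ pψ, eq_neg_iff_add_eq_zero,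
      ← intervalIntegral.integral_add (Continuous.intervalIntegrable (by fun_prop) _ _)
      (Continuous.intervalIntegrable (by fun_prop) _ _)] at e1
    rw [← e1]
    refine intervalIntegral.integral_congr fun x _ => ?_
    ring

/-! ### The nonlinearity near a critical point -/

theorem hasDerivAt_F (c σ α s : ℝ) : HasDerivAt (F c σ α) (-c + σ * s + α * s ^ 2) s := by
  have h := (((hasDerivAt_id s).const_mul (-c)).add
    ((hasDerivAt_pow 2 s).const_mul (σ / 2))).add ((hasDerivAt_pow 3 s).const_mul (α / 3))
  refine h.congr_deriv ?_
  simp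
  ring

theorem contDiff_F (c σ α : ℝ) {n : WithTop ℕ∞} : ContDiff ℝ n (F c σ α) := by
  unfold F
  fun_prop

/-- Taylor expansion of `F` at a critical point. -/
theorem F_sub_of_critical {c σ α s₀ : ℝ} (hs : σ * s₀ + α * s₀ ^ 2 = c) (s : ℝ) :
    F c σ α s - F c σ α s₀
      = (s - s₀) ^ 2 * ((σ + 2 * α * s₀) / 2 + α / 3 * (s - s₀)) := by
  rw [← hs]
  unfold F
  ring

theorem isLocalExtr_F {c σ α s₀ : ℝ} (hs : σ * s₀ + α * s₀ ^ 2 = c)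
    (hκ : σ + 2 * α * s₀ ≠ 0) : IsLocalExtr (F c σ α) s₀ := by
  have hcont : ContinuousAt (fun s => (σ + 2 * α * s₀) / 2 + α / 3 * (s - s₀)) s₀ := by fun_prop
  rcases lt_or_gt_of_ne hκ with h | h
  · right
    have h0 : (σ + 2 * α * s₀) / 2 + α / 3 * (s₀ - s₀) < 0 := by rw [sub_self]; linarith
    filter_upwards [hcont.tendsto.eventually_lt_const h0] with s h1
    nlinarith [F_sub_of_critical hs s, mul_nonneg (sq_nonneg (s - s₀)) (neg_nonneg.2 h1.le)]
  · left
    have h0 : 0 < (σ + 2 * α * s₀) / 2 + α / 3 * (s₀ - s₀) := by rw [sub_self]; linarith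
    filter_upwards [hcont.tendsto.eventually_const_lt h0] with s h1
    nlinarith [F_sub_of_critical hs s, mul_nonneg (sq_nonneg (s - s₀)) h1.le]

/-! ### The second-order equation in the case `β = 0` -/

/-- If `β = 0`, then `F(φ)` is twice differentiable with `F(φ)'' = φ`. -/
theorem IsSolution.exists_deriv_F {c σ α : ℝ} {φ : ℝ → ℝ} (h : IsSolution c 0 σ α φ) :
    ∃ w' : ℝ → ℝ, (∀ x, HasDerivAt (fun x => F c σ α (φ x)) (w' x) x) ∧
      ∀ x, HasDerivAt w' (φ x) x := by
  obtain ⟨v, v', Q, Q', B, K, hv, hv', -, hQ, hQ', hK⟩ := h.exists_potential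
  have e : Q = fun _ => K := funext fun x => by rw [hK]; ring
  have e' : Q' = fun _ => 0 := funext fun x => by
    have := hQ x
    rw [e] at this
    exact this.unique (hasDerivAt_const x K)
  have hF : (fun x => F c σ α (φ x)) = fun x => B - v x := funext fun x => by
    have := hQ' x
    rw [e'] at this
    linarith [this.unique (hasDerivAt_const x 0)]
  refine ⟨fun x => -v' x, fun x => ?_, fun x => ?_⟩
  · rw [hF]
    exact (hv x).const_sub B
  · exact (hv' x).fun_neg.congr_deriv (neg_neg _)

/-- Second-order Taylor expansion at a critical point. -/
theorem tendsto_div_sq {w w' : ℝ → ℝ} {x₀ s : ℝ} (hw : ∀ x, HasDerivAt w (w' x) x)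
    (hw' : HasDerivAt w' s x₀) (h0 : w' x₀ = 0) :
    Tendsto (fun x => (w x - w x₀) / (x - x₀) ^ 2) (𝓝[≠] x₀) (𝓝 (s / 2)) := by
  have hne : ∀ᶠ x in 𝓝[≠] x₀, x - x₀ ≠ 0 := by
    filter_upwards [self_mem_nhdsWithin] with x hx using sub_ne_zero.2 hx
  refine HasDerivAt.lhopital_zero_nhdsNE (f' := w') (g' := fun x => 2 * (x - x₀))
    (Eventually.of_forall fun x => (hw x).sub_const _) (Eventually.of_forall fun x => ?_)
    (hne.mono fun x hx => mul_ne_zero two_ne_zero hx) ?_ ?_ ?_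
  · refine (((hasDerivAt_id x).sub_const x₀).fun_pow 2).congr_deriv ?_
    simp
  · have := (hw x₀).continuousAt.tendsto.sub_const (w x₀)
    rw [sub_self] at this
    exact this.mono_left nhdsWithin_le_nhds
  · have : ContinuousAt (fun x => (x - x₀) ^ 2) x₀ := by fun_prop
    have := this.tendsto
    simp only [sub_self, ne_eq, OfNat.ofNat_ne_zero, not_false_eq_true, zero_pow] at this
    exact this.mono_left nhdsWithin_le_nhds
  · have := (hasDerivAt_iff_tendsto_slope.1 hw').div_const 2
    refine this.congr fun x => ?_
    rw [slope_def_field, h0, sub_zero, div_div, mul_comm]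

theorem contDiffOn_succ_of_hasDerivAt {f f' : ℝ → ℝ} {U : Set ℝ} (hU : IsOpen U) {n : ℕ}
    (hf : ∀ x, HasDerivAt f (f' x) x) (hf' : ContDiffOn ℝ n f' U) :
    ContDiffOn ℝ (n + 1 : ℕ) f U := by
  have e : deriv f = f' := funext fun x => (hf x).deriv
  push_cast
  rw [contDiffOn_succ_iff_deriv_of_isOpen hU, e]
  exact ⟨fun x _ => (hf x).differentiableAt.differentiableWithinAt, by simp, hf'⟩

/-- Where `F'(φ) ≠ 0`, the profile is recovered smoothly from `F(φ)`, and the equation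
`F(φ)'' = φ` bootstraps. -/
theorem contDiffOn_of_noncritical {c σ α : ℝ} {φ w' : ℝ → ℝ} (hc : Continuous φ)
    (hw : ∀ x, HasDerivAt (fun x => F c σ α (φ x)) (w' x) x) (hw' : ∀ x, HasDerivAt w' (φ x) x)
    {U : Set ℝ} (hU : IsOpen U) (hne : ∀ x ∈ U, -c + σ * φ x + α * φ x ^ 2 ≠ 0) :
    ContDiffOn ℝ ∞ φ U := by
  refine contDiffOn_infty.2 fun n => ?_
  induction n with
  | zero => exact_mod_cast contDiffOn_zero.2 hc.continuousOn
  | succ n ih =>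
    have hwn : ContDiffOn ℝ (n + 1 : ℕ) (fun x => F c σ α (φ x)) U :=
      contDiffOn_succ_of_hasDerivAt hU hw
        ((contDiffOn_succ_of_hasDerivAt hU hw' ih).of_le (by exact_mod_cast n.le_succ))
    intro x hx
    have hd := (hasDerivAt_F c σ α (φ x)).hasFDerivAt_equiv (hne x hx)
    have hcd : ContDiffAt ℝ (n + 1 : ℕ) (F c σ α) (φ x) := (contDiff_F c σ α).contDiffAt
    have hn : ((n + 1 : ℕ) : WithTop ℕ∞) ≠ 0 := by exact_mod_cast n.succ_ne_zero
    have hg := hcd.to_localInverse hd hn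
    have hcomp := hg.comp x ((hwn x hx).contDiffAt (hU.mem_nhds hx))
    have hinv := (hcd.hasStrictFDerivAt' hd hn).eventually_left_inverse
    refine (hcomp.congr_of_eventuallyEq ?_).contDiffWithinAt
    filter_upwards [hc.continuousAt.eventually hinv] with y hy
    exact hy.symm

/-- Since a nondegenerate critical value is extremal for `F`, the derivative of `F(φ)` vanishes
wherever `φ` takes this value, whether or not `φ` is differentiable there. -/
theorem deriv_F_eq_zero {c σ α s₀ : ℝ} {φ : ℝ → ℝ} {x w₁ : ℝ} (hs : σ * s₀ + α * s₀ ^ 2 = c)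
    (hκ : σ + 2 * α * s₀ ≠ 0) (hc : Continuous φ) (hx : φ x = s₀)
    (hw : HasDerivAt (fun x => F c σ α (φ x)) w₁ x) : w₁ = 0 := by
  have h : IsLocalExtr (F c σ α) (φ x) := hx ▸ isLocalExtr_F hs hκ
  have h' : IsLocalExtrOn (F c σ α ∘ φ) univ x := h.comp_continuousOn φ hc.continuousOn (mem_univ x)
  rw [isLocalExtrOn_univ_iff] at h'
  exact h'.hasDerivAt_eq_zero hw

/-- An extremum at a critical value of `F` is never smooth: if `φ` were differentiable, `F(φ)` would
be constant up to order two there, whereas its second derivative `φ` does not vanish. -/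
theorem not_differentiableAt_of_critical {c σ α : ℝ} (hc0 : 0 < c) {φ w' : ℝ → ℝ} {x₀ : ℝ}
    (hw : ∀ x, HasDerivAt (fun x => F c σ α (φ x)) (w' x) x) (hw' : ∀ x, HasDerivAt w' (φ x) x)
    (hext : IsLocalExtr φ x₀) (hs : σ * φ x₀ + α * φ x₀ ^ 2 = c) :
    ¬ DifferentiableAt ℝ φ x₀ := by
  intro hd
  have h0 : HasDerivAt φ 0 x₀ := by
    have := hd.hasDerivAt
    rwa [hext.deriv_eq_zero] at this
  have hw0 : w' x₀ = 0 := by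
    have := (hasDerivAt_F c σ α (φ x₀)).comp x₀ h0
    rw [mul_zero] at this
    exact (hw x₀).unique this
  have h1 := tendsto_div_sq hw (hw' x₀) hw0
  have h2 : Tendsto (fun x => (slope φ x₀ x) ^ 2 *
      ((σ + 2 * α * φ x₀) / 2 + α / 3 * (φ x - φ x₀))) (𝓝[≠] x₀)
      (𝓝 (0 ^ 2 * ((σ + 2 * α * φ x₀) / 2 + α / 3 * (φ x₀ - φ x₀)))) := by
    refine ((hasDerivAt_iff_tendsto_slope.1 h0).pow 2).mul ?_
    have : ContinuousAt (fun x => (σ + 2 * α * φ x₀) / 2 + α / 3 * (φ x - φ x₀)) x₀ := by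
      have := h0.continuousAt
      fun_prop
    exact this.tendsto.mono_left nhdsWithin_le_nhds
  have h3 := tendsto_nhds_unique h1 (h2.congr fun x => by
    rw [F_sub_of_critical hs, slope_def_field, div_pow]; ring)
  have : φ x₀ = 0 := by linarith
  rw [this] at hs
  simp at hs
  exact hc0.ne hs

/-! ### Profiles with a critical extremum -/

theorem preciselyHolderAt_of_tendsto {φ : ℝ → ℝ} {x₀ s L : ℝ} (hs : s ≠ 0) (hL : 0 < L)
    (h : Tendsto (fun x => |φ x - φ x₀| / |x - x₀| ^ s) (𝓝[≠] x₀) (𝓝 L)) :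
    PreciselyHolderAt s φ x₀ := by
  refine ⟨L / 2, 2 * L, by positivity, by positivity, ?_⟩
  have hev := (h.eventually (lt_mem_nhds (half_lt_self hL))).and
    (h.eventually (gt_mem_nhds (show L < 2 * L by linarith)))
  rw [eventually_nhdsWithin_iff] at hev
  filter_upwards [hev] with x hx
  rcases eq_or_ne x x₀ with rfl | hne
  · simp [zero_rpow hs]
  · have hpos : 0 < |x - x₀| ^ s := rpow_pos_of_pos (abs_pos.2 (sub_ne_zero.2 hne)) _
    obtain ⟨h1, h2⟩ := hx hne
    exact ⟨((lt_div_iff₀ hpos).1 h1).le, ((div_lt_iff₀ hpos).1 h2).le⟩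

/-- At a nondegenerate critical value, `((φ - s₀) / (x - x₀))²` converges. -/
theorem tendsto_slope_sq {c σ α : ℝ} {φ w' : ℝ → ℝ} {x₀ : ℝ} (hc : Continuous φ)
    (hw : ∀ x, HasDerivAt (fun x => F c σ α (φ x)) (w' x) x) (hw' : ∀ x, HasDerivAt w' (φ x) x)
    (hs : σ * φ x₀ + α * φ x₀ ^ 2 = c) (hκ : σ + 2 * α * φ x₀ ≠ 0) :
    Tendsto (fun x => slope φ x₀ x ^ 2) (𝓝[≠] x₀) (𝓝 (φ x₀ / (σ + 2 * α * φ x₀))) := by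
  have h1 := tendsto_div_sq hw (hw' x₀) (deriv_F_eq_zero hs hκ hc rfl (hw x₀))
  have hcont : ContinuousAt (fun x => (σ + 2 * α * φ x₀) / 2 + α / 3 * (φ x - φ x₀)) x₀ := by
    fun_prop
  have h0 : (σ + 2 * α * φ x₀) / 2 + α / 3 * (φ x₀ - φ x₀) ≠ 0 := by simpa using hκ
  have h2 := h1.div (hcont.tendsto.mono_left nhdsWithin_le_nhds) h0
  have e : φ x₀ / 2 / ((σ + 2 * α * φ x₀) / 2 + α / 3 * (φ x₀ - φ x₀))
      = φ x₀ / (σ + 2 * α * φ x₀) := by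
    rw [sub_self, mul_zero, add_zero, div_div_div_cancel_right₀ two_ne_zero]
  rw [e] at h2
  refine h2.congr' ?_
  filter_upwards [(hcont.eventually_ne h0).filter_mono nhdsWithin_le_nhds] with x hx
  rw [Pi.div_apply, F_sub_of_critical hs, slope_def_field, div_pow, mul_div_right_comm,
    mul_div_assoc, div_self hx, mul_one]

/-- The behaviour of a profile at an extremum with a nondegenerate critical value: a corner, with
the slopes given by `((φ - s₀) / (x - x₀))² → s₀ / (σ + 2 α s₀)`. The sign `τ` is `1` at maxima
and `-1` at minima. -/
theorem corner_of_nondegenerate {c σ α : ℝ} (hc0 : 0 < c) {φ w' : ℝ → ℝ} {x₀ τ : ℝ}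
    (hc : Continuous φ)
    (hw : ∀ x, HasDerivAt (fun x => F c σ α (φ x)) (w' x) x) (hw' : ∀ x, HasDerivAt w' (φ x) x)
    (hτ : τ = 1 ∨ τ = -1) (hext : ∀ x, 0 ≤ τ * (φ x₀ - φ x))
    (hs : σ * φ x₀ + α * φ x₀ ^ 2 = c) (hκ : σ + 2 * α * φ x₀ ≠ 0) :
    PreciselyHolderAt 1 φ x₀ ∧
      ∃ dL dR : ℝ,
        HasDerivWithinAt φ dL (Iio x₀) x₀ ∧ Tendsto (deriv φ) (𝓝[<] x₀) (𝓝 dL) ∧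
        HasDerivWithinAt φ dR (Ioi x₀) x₀ ∧ Tendsto (deriv φ) (𝓝[>] x₀) (𝓝 dR) ∧
        |dL| ^ 2 = |φ x₀| / |σ + 2 * α * φ x₀| ∧
        |dR| ^ 2 = |φ x₀| / |σ + 2 * α * φ x₀| := by
  set κ := σ + 2 * α * φ x₀ with hκdef
  have hττ : τ * τ = 1 := by rcases hτ with rfl | rfl <;> norm_num
  have hs0 : φ x₀ ≠ 0 := fun h => by
    rw [h] at hs
    simp at hs
    exact hc0.ne hs
  have hsq := tendsto_slope_sq hc hw hw' hs hκ
  have hq0 : 0 < φ x₀ / κ := by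
    refine lt_of_le_of_ne (ge_of_tendsto' hsq fun x => sq_nonneg _) ?_
    exact (div_ne_zero hs0 hκ).symm
  set L := √(φ x₀ / κ) with hLdef
  have hL : 0 < L := Real.sqrt_pos.2 hq0
  have hLsq : L ^ 2 = φ x₀ / κ := Real.sq_sqrt hq0.le
  -- Since `φ - φ x₀` has the sign of `-τ`, so do the difference quotients to the right of `x₀`, and
  -- those to the left have the sign of `τ`.
  have habs : Tendsto (fun x => |slope φ x₀ x|) (𝓝[≠] x₀) (𝓝 L) := by
    have := (Real.continuous_sqrt.tendsto _).comp hsq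
    exact this.congr fun x => Real.sqrt_sq_eq_abs _
  have hR : Tendsto (slope φ x₀) (𝓝[>] x₀) (𝓝 (-τ * L)) := by
    have := (habs.mono_left (nhdsWithin_mono x₀ fun x (hx : x₀ < x) => hx.ne')).const_mul (-τ)
    refine this.congr' ?_
    filter_upwards [self_mem_nhdsWithin] with x hx
    have hx' : 0 < x - x₀ := sub_pos.2 hx
    have h1 : |slope φ x₀ x| = τ * (φ x₀ - φ x) / (x - x₀) := by
      rw [slope_def_field, abs_div, abs_of_pos hx', ← abs_of_nonneg (hext x), abs_mul, abs_sub_comm]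
      rcases hτ with rfl | rfl <;> simp
    rw [h1, slope_def_field, ← mul_div_assoc]
    congr 1
    linear_combination (φ x - φ x₀) * hττ
  have hLf : Tendsto (slope φ x₀) (𝓝[<] x₀) (𝓝 (τ * L)) := by
    have := (habs.mono_left (nhdsWithin_mono x₀ fun x (hx : x < x₀) => hx.ne)).const_mul τ
    refine this.congr' ?_
    filter_upwards [self_mem_nhdsWithin] with x hx
    have hx' : x - x₀ < 0 := sub_neg.2 hx
    have h1 : |slope φ x₀ x| = τ * (φ x₀ - φ x) / -(x - x₀) := by
      rw [slope_def_field, abs_div, abs_of_neg hx', ← abs_of_nonneg (hext x), abs_mul, abs_sub_comm]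
      rcases hτ with rfl | rfl <;> simp
    rw [h1, slope_def_field, ← mul_div_assoc, div_neg, ← neg_div]
    congr 1
    linear_combination (φ x - φ x₀) * hττ
  -- Away from `x₀`, `φ' = F(φ)' / F'(φ)`, and both factors are asymptotically linear in `x - x₀`.
  have hderiv : ∀ {l : Filter ℝ} {d : ℝ}, l ≤ 𝓝[≠] x₀ → d ^ 2 = φ x₀ / κ →
      Tendsto (slope φ x₀) l (𝓝 d) → Tendsto (deriv φ) l (𝓝 d) := by
    intro l d hl hd hsl
    have hd0 : d ≠ 0 := by
      intro h
      rw [h] at hd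
      exact hq0.ne (by rw [← hd]; ring)
    have hφ : Tendsto φ l (𝓝 (φ x₀)) :=
      (hc.tendsto x₀).mono_left (hl.trans nhdsWithin_le_nhds)
    have hw0 := deriv_F_eq_zero hs hκ hc rfl (hw x₀)
    have h1 := (hasDerivAt_iff_tendsto_slope.1 (hw' x₀)).mono_left hl
    have h2 : Tendsto (fun x => slope φ x₀ x * (κ + α * (φ x - φ x₀))) l
        (𝓝 (d * (κ + α * (φ x₀ - φ x₀)))) :=
      hsl.mul ((hφ.sub_const _ |>.const_mul α).const_add κ)
    have hne : d * (κ + α * (φ x₀ - φ x₀)) ≠ 0 := by simp [hd0, hκ]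
    have h3 := h1.div h2 hne
    have e : φ x₀ / (d * (κ + α * (φ x₀ - φ x₀))) = d := by
      rw [sub_self, mul_zero, add_zero, div_eq_iff (mul_ne_zero hd0 hκ)]
      rw [eq_div_iff hκ] at hd
      linear_combination -hd
    rw [e] at h3
    refine h3.congr' ?_
    filter_upwards [h2.eventually_ne hne, hl self_mem_nhdsWithin] with x hx hxx
    have hxx' : x - x₀ ≠ 0 := sub_ne_zero.2 hxx
    have e2 : -c + σ * φ x + α * φ x ^ 2 = (x - x₀) * (slope φ x₀ x * (κ + α * (φ x - φ x₀))) := by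
      rw [slope_def_field, ← hs, hκdef]
      field_simp
      ring
    have hF' : -c + σ * φ x + α * φ x ^ 2 ≠ 0 := by
      rw [e2]
      exact mul_ne_zero hxx' hx
    have hopen : IsOpen {y | -c + σ * φ y + α * φ y ^ 2 ≠ 0} :=
      isOpen_ne_fun (by fun_prop) continuous_const
    have hdiff : DifferentiableAt ℝ φ x :=
      ((contDiffOn_of_noncritical hc hw hw' hopen fun y hy => hy).contDiffAt
        (hopen.mem_nhds hF')).differentiableAt (by simp)
    have e3 : w' x = (-c + σ * φ x + α * φ x ^ 2) * deriv φ x :=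
      (hw x).unique ((hasDerivAt_F c σ α (φ x)).comp x hdiff.hasDerivAt)
    rw [Pi.div_apply, slope_def_field w', hw0, sub_zero, e3, e2, div_div,
      mul_div_cancel_left₀ _ (mul_ne_zero hxx' hx)]
  have hval : ∀ d : ℝ, d ^ 2 = L ^ 2 → |d| ^ 2 = |φ x₀| / |κ| := fun d hd => by
    rw [sq_abs, hd, hLsq, ← abs_div, abs_of_pos hq0]
  have eL : (τ * L) ^ 2 = L ^ 2 := by linear_combination L ^ 2 * hττ
  have eR : (-τ * L) ^ 2 = L ^ 2 := by linear_combination L ^ 2 * hττ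
  refine ⟨preciselyHolderAt_of_tendsto one_ne_zero hL (habs.congr fun x => ?_),
    τ * L, -τ * L, ?_, ?_, ?_, ?_, hval _ eL, hval _ eR⟩
  · rw [slope_def_field, abs_div, rpow_one]
  · exact (hasDerivWithinAt_iff_tendsto_slope' (by simp)).2 hLf
  · exact hderiv (nhdsWithin_mono x₀ fun x (hx : x < x₀) => hx.ne) (eL.trans hLsq) hLf
  · exact (hasDerivWithinAt_iff_tendsto_slope' (by simp)).2 hR
  · exact hderiv (nhdsWithin_mono x₀ fun x (hx : x₀ < x) => hx.ne') (eR.trans hLsq) hR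

/-- The behaviour of a profile at an extremum with a degenerate critical value, where
`F(s) - F(s₀) = α (s - s₀)³ / 3`: a cusp. -/
theorem cusp_of_degenerate {c σ α : ℝ} (hc0 : 0 < c) {φ w' : ℝ → ℝ} {x₀ τ : ℝ}
    (hw : ∀ x, HasDerivAt (fun x => F c σ α (φ x)) (w' x) x) (hw' : ∀ x, HasDerivAt w' (φ x) x)
    (hτ : τ = 1 ∨ τ = -1) (hext : ∀ x, 0 ≤ τ * (φ x₀ - φ x))
    (hs : σ * φ x₀ + α * φ x₀ ^ 2 = c) (hκ : σ + 2 * α * φ x₀ = 0) (hα : α < 0) :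
    PreciselyHolderAt (2 / 3) φ x₀ ∧
      Tendsto (fun x => |φ x - φ x₀| / |x - x₀| ^ (2 / 3 : ℝ)) (𝓝[≠] x₀)
        (𝓝 ((3 * |φ x₀| / (2 * |α|)) ^ (1 / 3 : ℝ))) := by
  have hs0 : φ x₀ ≠ 0 := fun h => by
    rw [h] at hs
    simp at hs
    exact hc0.ne hs
  have hF : ∀ x, F c σ α (φ x) - F c σ α (φ x₀) = α / 3 * (φ x - φ x₀) ^ 3 := fun x => by
    rw [F_sub_of_critical hs, hκ]
    ring
  have hw0 : w' x₀ = 0 := by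
    have : IsLocalExtr (fun x => F c σ α (φ x)) x₀ := by
      rcases hτ with rfl | rfl
      · refine Or.inl (Eventually.of_forall fun x => ?_)
        have h1 : 0 ≤ φ x₀ - φ x := by simpa using hext x
        have := mul_nonneg (neg_nonneg.2 hα.le) (pow_nonneg h1 3)
        linarith [hF x, show (φ x₀ - φ x) ^ 3 = -(φ x - φ x₀) ^ 3 by ring]
      · refine Or.inr (Eventually.of_forall fun x => ?_)
        have h1 : 0 ≤ φ x - φ x₀ := by simpa using hext x
        have := mul_nonneg (neg_nonneg.2 hα.le) (pow_nonneg h1 3)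
        linarith [hF x]
    exact this.hasDerivAt_eq_zero (hw x₀)
  have h1 := ((tendsto_div_sq hw (hw' x₀) hw0).const_mul (3 / α)).abs
  have h2 := h1.rpow_const (p := 1 / 3) (Or.inr (by norm_num))
  have hαne := hα.ne
  have e : |3 / α * (φ x₀ / 2)| = 3 * |φ x₀| / (2 * |α|) := by
    rw [abs_mul, abs_div, abs_div, abs_of_pos (show (0 : ℝ) < 3 by norm_num), abs_two]
    field_simp
  rw [e] at h2
  have h3 : Tendsto (fun x => |φ x - φ x₀| / |x - x₀| ^ (2 / 3 : ℝ)) (𝓝[≠] x₀)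
        (𝓝 ((3 * |φ x₀| / (2 * |α|)) ^ (1 / 3 : ℝ))) := by
    refine h2.congr fun x => ?_
    have e1 : 3 / α * ((F c σ α (φ x) - F c σ α (φ x₀)) / (x - x₀) ^ 2)
        = (φ x - φ x₀) ^ 3 / (x - x₀) ^ 2 := by
      rw [hF]
      field_simp
    rw [e1, abs_div, abs_pow, abs_pow, div_rpow (by positivity) (by positivity),
      ← rpow_natCast, ← rpow_natCast, ← rpow_mul (abs_nonneg _), ← rpow_mul (abs_nonneg _)]
    norm_num
  have := abs_pos.2 hαne
  have := abs_pos.2 hs0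
  exact ⟨preciselyHolderAt_of_tendsto (by norm_num) (by positivity) h3, h3⟩

/-! ### Amplitude bounds -/

/-- A profile cannot exceed a positive value at which `F(φ)'` is forced to vanish: on a component of
`{φ > s₀}` the function `w' = F(φ)'` would vanish at both ends but have the positive derivative
`φ`. -/
theorem le_of_deriv_eq_zero {φ w' : ℝ → ℝ} {s₀ y : ℝ} (hc : Continuous φ)
    (hp : Function.Periodic φ (2 * π)) (hw' : ∀ x, HasDerivAt w' (φ x) x) (hs₀ : 0 < s₀)
    (h0 : ∀ x, φ x = s₀ → w' x = 0) (hy : φ y < s₀) (z : ℝ) : φ z ≤ s₀ := by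
  by_contra! hz
  have hlt : ∀ n : ℤ, φ (y + n * (2 * π)) < s₀ := fun n => by rwa [hp.int_mul n y]
  obtain ⟨n, hn⟩ := exists_int_lt ((z - y) / (2 * π))
  obtain ⟨m, hm⟩ := exists_int_gt ((z - y) / (2 * π))
  rw [lt_div_iff₀ two_pi_pos] at hn
  rw [div_lt_iff₀ two_pi_pos] at hm
  -- `(p, q)` is the component of `{φ > s₀}` that contains `z`.
  have hA : IsCompact (Icc (y + n * (2 * π)) z ∩ φ ⁻¹' Iic s₀) :=
    isCompact_Icc.inter_right (isClosed_Iic.preimage hc)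
  have hB : IsCompact (Icc z (y + m * (2 * π)) ∩ φ ⁻¹' Iic s₀) :=
    isCompact_Icc.inter_right (isClosed_Iic.preimage hc)
  obtain ⟨p, ⟨⟨hp1, hp2⟩, hp3⟩, hp4⟩ := hA.exists_isGreatest
    ⟨y + n * (2 * π), ⟨le_rfl, by linarith⟩, (hlt n).le⟩
  obtain ⟨q, ⟨⟨hq1, hq2⟩, hq3⟩, hq4⟩ := hB.exists_isLeast
    ⟨y + m * (2 * π), ⟨by linarith, le_rfl⟩, (hlt m).le⟩
  simp only [mem_preimage, mem_Iic] at hp3 hq3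
  have hp5 : φ p = s₀ := by
    obtain ⟨t, ht, hts⟩ := intermediate_value_Icc hp2 hc.continuousOn ⟨hp3, hz.le⟩
    have := hp4 ⟨⟨hp1.trans ht.1, ht.2⟩, hts.le⟩
    rw [← le_antisymm this ht.1, hts]
  have hq5 : φ q = s₀ := by
    obtain ⟨t, ht, hts⟩ := intermediate_value_Icc' hq1 hc.continuousOn ⟨hq3, hz.le⟩
    have := hq4 ⟨⟨ht.1, ht.2.trans hq2⟩, hts.le⟩
    rw [← le_antisymm ht.2 this, hts]
  have hpz : p < z := lt_of_le_of_ne hp2 (by rintro rfl; linarith)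
  have hzq : z < q := lt_of_le_of_ne hq1 (by rintro rfl; linarith)
  obtain ⟨t, ht, ht0⟩ := exists_hasDerivAt_eq_zero (hpz.trans hzq)
    (fun x _ => (hw' x).continuousAt.continuousWithinAt)
    ((h0 p hp5).trans (h0 q hq5).symm) (fun x _ => hw' x)
  have : s₀ < φ t := by
    by_contra! hle
    rcases le_total t z with htz | htz
    · exact absurd (hp4 ⟨⟨hp1.trans ht.1.le, htz⟩, hle⟩) (not_le.2 ht.1)
    · exact absurd (hq4 ⟨⟨htz, ht.2.le.trans hq2⟩, hle⟩) (not_le.2 ht.2)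
  linarith

theorem exists_nonpos_of_mean_zero {φ : ℝ → ℝ} (hc : Continuous φ)
    (hm : ∫ x in (-π)..π, φ x = 0) : ∃ y, φ y ≤ 0 := by
  by_contra! h
  exact (intervalIntegral.intervalIntegral_pos_of_pos (hc.intervalIntegrable _ _) h
    (by linarith [pi_pos])).ne' hm

theorem IsSolution.le_of_critical {c σ α s₀ : ℝ} {φ : ℝ → ℝ} (h : IsSolution c 0 σ α φ)
    (hs₀ : 0 < s₀) (hs : σ * s₀ + α * s₀ ^ 2 = c) (hκ : σ + 2 * α * s₀ ≠ 0) (x : ℝ) :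
    φ x ≤ s₀ := by
  obtain ⟨w', hw, hw'⟩ := h.exists_deriv_F
  obtain ⟨y, hy⟩ := exists_nonpos_of_mean_zero h.continuous h.mean_zero
  exact le_of_deriv_eq_zero h.continuous h.periodic hw' hs₀
    (fun x hx => deriv_F_eq_zero hs hκ h.continuous hx (hw x)) (hy.trans_lt hs₀) x

theorem IsSolution.ge_of_critical {c σ α s₀ : ℝ} {φ : ℝ → ℝ} (h : IsSolution c 0 σ α φ)
    (hs₀ : s₀ < 0) (hs : σ * s₀ + α * s₀ ^ 2 = c) (hκ : σ + 2 * α * s₀ ≠ 0) (x : ℝ) :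
    s₀ ≤ φ x := by
  obtain ⟨w', hw, hw'⟩ := h.exists_deriv_F
  obtain ⟨y, hy⟩ := exists_nonpos_of_mean_zero h.continuous.neg (by simp [h.mean_zero])
  have := le_of_deriv_eq_zero (φ := -φ) (w' := -w') (s₀ := -s₀) h.continuous.neg
    (fun x => by simp [h.periodic x])
    (fun x => (hw' x).neg) (neg_pos.2 hs₀)
    (fun x hx => by
      simp [deriv_F_eq_zero hs hκ h.continuous (neg_inj.1 hx) (hw x)])
    (hy.trans_lt (neg_pos.2 hs₀)) x
  exact neg_le_neg_iff.1 this

/-! ### The critical values as roots of `F'` -/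

/-- The roots `s` of `F'`, for `α ≠ 0`, are given by `(s + σ/(2α))² = σ²/(4α²) + c/α`. -/
theorem critical_of_sq {c σ α s : ℝ} (hα : α ≠ 0)
    (h : (s + σ / (2 * α)) ^ 2 = σ ^ 2 / (4 * α ^ 2) + c / α) : σ * s + α * s ^ 2 = c := by
  field_simp at h
  have h4 : 4 * α * (σ * s + α * s ^ 2 - c) = 0 := by linear_combination h / 4
  linarith [(mul_eq_zero.1 h4).resolve_left (by positivity)]

theorem nondegenerate_of_sq {c σ α s : ℝ} (hα : α ≠ 0)
    (h : (s + σ / (2 * α)) ^ 2 = σ ^ 2 / (4 * α ^ 2) + c / α)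
    (hd : σ ^ 2 / (4 * α ^ 2) + c / α ≠ 0) : σ + 2 * α * s ≠ 0 := by
  intro h0
  rw [← h] at hd
  refine hd ?_
  have : s + σ / (2 * α) = 0 := by
    field_simp
    linear_combination h0
  rw [this]
  ring

theorem critPlus_sq {c σ α : ℝ} (hd : 0 ≤ σ ^ 2 / (4 * α ^ 2) + c / α) :
    (critPlus c σ α + σ / (2 * α)) ^ 2 = σ ^ 2 / (4 * α ^ 2) + c / α := by
  rw [← Real.sq_sqrt hd, critPlus]
  ring

theorem critMinus_sq {c σ α : ℝ} (hd : 0 ≤ σ ^ 2 / (4 * α ^ 2) + c / α) :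
    (critMinus c σ α + σ / (2 * α)) ^ 2 = σ ^ 2 / (4 * α ^ 2) + c / α := by
  rw [← Real.sq_sqrt hd, critMinus]
  ring

theorem disc_eq {c σ α : ℝ} (hc : 0 < c) (hα : α ≠ 0) :
    σ ^ 2 / (4 * α ^ 2) + c / α = c / α ^ 2 * (α - -(σ ^ 2 / (4 * c))) := by
  field_simp
  ring

theorem disc_pos {c σ α : ℝ} (hc : 0 < c) (hα : α ≠ 0) (h : -(σ ^ 2 / (4 * c)) < α) :
    0 < σ ^ 2 / (4 * α ^ 2) + c / α := by
  rw [disc_eq hc hα]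
  exact mul_pos (by positivity) (sub_pos.2 h)

theorem disc_nonneg {c σ α : ℝ} (hc : 0 < c) (hα : α ≠ 0) (h : -(σ ^ 2 / (4 * c)) ≤ α) :
    0 ≤ σ ^ 2 / (4 * α ^ 2) + c / α := by
  rw [disc_eq hc hα]
  exact mul_nonneg (by positivity) (sub_nonneg.2 h)

theorem neg_sq_div_lt_of_pos {c σ α : ℝ} (hc : 0 < c) (hα : 0 < α) : -(σ ^ 2 / (4 * c)) < α :=
  lt_of_le_of_lt (neg_nonpos.2 (by positivity)) hα

theorem critPlus_pos {c σ α : ℝ} (hc : 0 < c) (hα : 0 < α) : 0 < critPlus c σ α := by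
  have h : |σ / (2 * α)| < √(σ ^ 2 / (4 * α ^ 2) + c / α) := by
    rw [← Real.sqrt_sq_eq_abs]
    refine Real.sqrt_lt_sqrt (sq_nonneg _) ?_
    have : (σ / (2 * α)) ^ 2 = σ ^ 2 / (4 * α ^ 2) := by ring
    rw [this]
    have : 0 < c / α := by positivity
    linarith
  rw [critPlus, neg_div]
  linarith [le_abs_self (σ / (2 * α))]

theorem critMinus_neg {c σ α : ℝ} (hc : 0 < c) (hα : 0 < α) : critMinus c σ α < 0 := by
  have := critPlus_pos (σ := -σ) hc hα
  rw [critPlus, neg_sq] at this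
  rw [critMinus]
  rw [neg_neg] at this
  rw [neg_div]
  linarith

theorem critMinus_pos {c σ α : ℝ} (hc : 0 < c) (hα : α < 0) (hσ : 0 < σ) :
    0 < critMinus c σ α := by
  have hpos : 0 < -σ / (2 * α) := div_pos_of_neg_of_neg (by linarith) (by linarith)
  have h : √(σ ^ 2 / (4 * α ^ 2) + c / α) < -σ / (2 * α) := by
    rw [Real.sqrt_lt' hpos]
    have : (-σ / (2 * α)) ^ 2 = σ ^ 2 / (4 * α ^ 2) := by ring
    rw [this]
    have : c / α < 0 := div_neg_of_pos_of_neg hc hα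
    linarith
  rw [critMinus]
  linarith

theorem critPlus_neg {c σ α : ℝ} (hc : 0 < c) (hα : α < 0) (hσ : σ < 0) :
    critPlus c σ α < 0 := by
  have := critMinus_pos (σ := -σ) hc hα (by linarith)
  rw [critMinus, neg_sq, neg_neg] at this
  rw [critPlus, neg_div]
  linarith

/-- The cases of a critical extremum have in common that `x₀` is an extremal point of `φ` where
`F'(φ) = 0`, which is degenerate precisely if `α = -σ² / (4c)`. -/
theorem AttainsCritical.data {c σ α : ℝ} (hc : 0 < c) {φ : ℝ → ℝ} {x₀ : ℝ}
    (h : AttainsCritical c σ α φ x₀) :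
    (∃ τ : ℝ, (τ = 1 ∨ τ = -1) ∧ ∀ x, 0 ≤ τ * (φ x₀ - φ x)) ∧
      σ * φ x₀ + α * φ x₀ ^ 2 = c ∧
      (-(σ ^ 2 / (4 * c)) < α → σ + 2 * α * φ x₀ ≠ 0) ∧
      (α = -(σ ^ 2 / (4 * c)) → σ + 2 * α * φ x₀ = 0 ∧ α < 0) := by
  have key : ∀ s, α ≠ 0 → (s + σ / (2 * α)) ^ 2 = σ ^ 2 / (4 * α ^ 2) + c / α →
      (α = -(σ ^ 2 / (4 * c)) → α < 0) →
      σ * s + α * s ^ 2 = c ∧ (-(σ ^ 2 / (4 * c)) < α → σ + 2 * α * s ≠ 0) ∧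
      (α = -(σ ^ 2 / (4 * c)) → σ + 2 * α * s = 0 ∧ α < 0) := by
    intro s hα hsq hneg
    refine ⟨critical_of_sq hα hsq,
      fun hlt => nondegenerate_of_sq hα hsq (disc_pos hc hα hlt).ne', fun heq => ⟨?_, hneg heq⟩⟩
    rw [disc_eq hc hα, ← heq, sub_self, mul_zero] at hsq
    have := pow_eq_zero_iff two_ne_zero |>.1 hsq
    field_simp at this
    linear_combination this
  have hmax : ∀ v, MaxAt φ x₀ v → ∃ τ : ℝ, (τ = 1 ∨ τ = -1) ∧ ∀ x, 0 ≤ τ * (φ x₀ - φ x) :=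
    fun v hv => ⟨1, Or.inl rfl, fun x => by linarith [hv.1 x]⟩
  have hmin : ∀ v, MinAt φ x₀ v → ∃ τ : ℝ, (τ = 1 ∨ τ = -1) ∧ ∀ x, 0 ≤ τ * (φ x₀ - φ x) :=
    fun v hv => ⟨-1, Or.inr rfl, fun x => by linarith [hv.1 x]⟩
  have hzero : α = 0 → σ ≠ 0 → φ x₀ = critZero c σ → σ * φ x₀ + α * φ x₀ ^ 2 = c ∧
      (-(σ ^ 2 / (4 * c)) < α → σ + 2 * α * φ x₀ ≠ 0) ∧
      (α = -(σ ^ 2 / (4 * c)) → σ + 2 * α * φ x₀ = 0 ∧ α < 0) := by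
    intro hα hσ hv
    refine ⟨?_, fun _ => by simp [hα, hσ], fun h0 => ?_⟩
    · rw [hv, hα, critZero]
      field_simp
      ring
    · have : 0 < σ ^ 2 / (4 * c) := by positivity
      linarith
  rcases h with ⟨h1, h2, h3, h⟩ | ⟨h1, h2, h3, h⟩ | ⟨h1, h2, h⟩ | ⟨h1, h2, h⟩ | ⟨h1, h | h⟩
  · refine ⟨hmax _ h, key _ h2.ne ?_ fun _ => h2⟩
    rw [h.2, critMinus_sq (disc_nonneg hc h2.ne h1)]
  · refine ⟨hmin _ h, key _ h2.ne ?_ fun _ => h2⟩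
    rw [h.2, critPlus_sq (disc_nonneg hc h2.ne h1)]
  · exact ⟨hmax _ h, hzero h1 h2.ne' h.2⟩
  · exact ⟨hmin _ h, hzero h1 h2.ne h.2⟩
  · have hlt := neg_sq_div_lt_of_pos (σ := σ) hc h1
    refine ⟨hmax _ h, key _ h1.ne' ?_ fun h0 => absurd h0 hlt.ne'⟩
    rw [h.2, critPlus_sq (disc_pos hc h1.ne' hlt).le]
  · have hlt := neg_sq_div_lt_of_pos (σ := σ) hc h1
    refine ⟨hmin _ h, key _ h1.ne' ?_ fun h0 => absurd h0 hlt.ne'⟩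
    rw [h.2, critMinus_sq (disc_pos hc h1.ne' hlt).le]

/-! ### The fourth-order system in the case `β ≠ 0` -/

/-- The steady equation with `β ≠ 0` as a system: the profile `φ` and its potential `v` satisfy
`β φ'' = -(F(φ) + v - B)` and `v'' = -φ`. -/
structure IsWave (c β σ α B : ℝ) (φ φ' v v' : ℝ → ℝ) : Prop where
  hasDerivAt : ∀ x, HasDerivAt φ (φ' x) x
  hasDerivAt' : ∀ x, HasDerivAt φ' (-(F c σ α (φ x) + v x - B) / β) x
  hasDerivAt_pot : ∀ x, HasDerivAt v (v' x) x
  hasDerivAt_pot' : ∀ x, HasDerivAt v' (-φ x) x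
  periodic : Function.Periodic φ (2 * π)
  periodic_pot : Function.Periodic v (2 * π)

theorem IsSolution.exists_isWave {c β σ α : ℝ} (hβ : β ≠ 0) {φ : ℝ → ℝ}
    (h : IsSolution c β σ α φ) : ∃ B φ' v v', IsWave c β σ α B φ φ' v v' := by
  obtain ⟨v, v', Q, Q', B, K, hv, hv', pv, hQ, hQ', hK⟩ := h.exists_potential
  have e : φ = fun x => (K - Q x) / β := funext fun x => by
    rw [hK]
    field_simp
    ring
  refine ⟨B, fun x => -Q' x / β, v, v', fun x => ?_, fun x => ?_, hv, hv', h.periodic, pv⟩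
  · have := ((hQ x).const_sub K).div_const β
    rwa [← e] at this
  · exact (hQ' x).fun_neg.div_const β

namespace IsWave

variable {c β σ α B : ℝ} {φ φ' v v' : ℝ → ℝ}

theorem continuous (h : IsWave c β σ α B φ φ' v v') : Continuous φ :=
  continuous_iff_continuousAt.2 fun x => (h.hasDerivAt x).continuousAt

theorem continuous' (h : IsWave c β σ α B φ φ' v v') : Continuous φ' :=
  continuous_iff_continuousAt.2 fun x => (h.hasDerivAt' x).continuousAt

theorem contDiff (h : IsWave c β σ α B φ φ' v v') : ContDiff ℝ ∞ φ := by
  have succ : ∀ {f f' : ℝ → ℝ} {n : ℕ}, (∀ x, HasDerivAt f (f' x) x) → ContDiff ℝ n f' →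
      ContDiff ℝ (n + 1 : ℕ) f := fun hf hf' =>
    contDiffOn_univ.1 (contDiffOn_succ_of_hasDerivAt isOpen_univ hf hf'.contDiffOn)
  have pred : ∀ {f : ℝ → ℝ} {n : ℕ}, ContDiff ℝ (n + 1 : ℕ) f → ContDiff ℝ n f := fun {f n} hf =>
    hf.of_le (by exact_mod_cast n.le_succ)
  refine contDiff_infty.2 fun n => ?_
  induction n with
  | zero => exact_mod_cast contDiff_zero.2 h.continuous
  | succ n ih =>
    have hv : ContDiff ℝ n v :=
      pred (succ h.hasDerivAt_pot (pred (succ h.hasDerivAt_pot' ih.neg)))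
    have hF : ContDiff ℝ n fun x => -(F c σ α (φ x) + v x - B) / β :=
      ((((contDiff_F c σ α).comp ih).add hv).sub contDiff_const).neg.div_const β
    exact succ h.hasDerivAt (pred (succ h.hasDerivAt' hF))

/-- The system is invariant under `x ↦ -x`. -/
theorem reflect (h : IsWave c β σ α B φ φ' v v') :
    IsWave c β σ α B (fun x => φ (-x)) (fun x => -φ' (-x)) (fun x => v (-x))
      (fun x => -v' (-x)) where
  hasDerivAt x := ((h.hasDerivAt (-x)).comp x (hasDerivAt_neg x)).congr_deriv (by ring)
  hasDerivAt' x := by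
    refine (((h.hasDerivAt' (-x)).comp x (hasDerivAt_neg x)).neg).congr_deriv ?_
    ring
  hasDerivAt_pot x :=
    ((h.hasDerivAt_pot (-x)).comp x (hasDerivAt_neg x)).congr_deriv (by ring)
  hasDerivAt_pot' x :=
    ((h.hasDerivAt_pot' (-x)).comp x (hasDerivAt_neg x)).neg.congr_deriv (by ring)
  periodic x := by
    change φ (-(x + 2 * π)) = φ (-x)
    rw [← h.periodic (-(x + 2 * π))]
    ring_nf
  periodic_pot x := by
    change v (-(x + 2 * π)) = v (-x)
    rw [← h.periodic_pot (-(x + 2 * π))]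
    ring_nf

/-! ### A profile that is constant on an interval vanishes -/

/-- Unique continuation: with `q = F(φ)/φ`, the system is linear with bounded coefficients. -/
theorem eq_zero_of_initial (h : IsWave c β σ α B φ φ' v v') {x₀ : ℝ} (h0 : φ x₀ = 0)
    (h1 : φ' x₀ = 0) (h2 : v x₀ = B) (h3 : v' x₀ = 0) (x : ℝ) : φ x = 0 := by
  let q : ℝ → ℝ := fun x => -c + σ / 2 * φ x + α / 3 * φ x ^ 2
  have hq : Continuous q := by
    have := h.continuous
    fun_prop
  obtain ⟨M, hM⟩ := EvenHolder.bdd_of_periodic hq fun x => by simp only [q, h.periodic x]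
  have hM' : ∀ t, |q t| ≤ M := fun t => hM ⟨t, rfl⟩
  have hM0 : 0 ≤ M := (abs_nonneg _).trans (hM' 0)
  let p1 : ℝ × ℝ × ℝ × ℝ →L[ℝ] ℝ := ContinuousLinearMap.fst ℝ ℝ (ℝ × ℝ × ℝ)
  let r1 : ℝ × ℝ × ℝ × ℝ →L[ℝ] ℝ × ℝ × ℝ := ContinuousLinearMap.snd ℝ ℝ (ℝ × ℝ × ℝ)
  let p2 : ℝ × ℝ × ℝ × ℝ →L[ℝ] ℝ := (ContinuousLinearMap.fst ℝ ℝ (ℝ × ℝ)).comp r1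
  let r2 : ℝ × ℝ × ℝ × ℝ →L[ℝ] ℝ × ℝ := (ContinuousLinearMap.snd ℝ ℝ (ℝ × ℝ)).comp r1
  let p3 : ℝ × ℝ × ℝ × ℝ →L[ℝ] ℝ := (ContinuousLinearMap.fst ℝ ℝ ℝ).comp r2
  let p4 : ℝ × ℝ × ℝ × ℝ →L[ℝ] ℝ := (ContinuousLinearMap.snd ℝ ℝ ℝ).comp r2
  let A : ℝ × ℝ × ℝ × ℝ →L[ℝ] ℝ × ℝ × ℝ × ℝ := p2.prod ((-β⁻¹ • p3).prod (p4.prod (-p1)))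
  let C : ℝ × ℝ × ℝ × ℝ →L[ℝ] ℝ × ℝ × ℝ × ℝ := (0 : ℝ × ℝ × ℝ × ℝ →L[ℝ] ℝ).prod ((-β⁻¹ • p1).prod 0)
  have hlip : ∀ t, LipschitzOnWith (‖A‖₊ + ⟨M, hM0⟩ * ‖C‖₊) (fun e => (A + q t • C) e) univ := by
    intro t
    refine ((A + q t • C).lipschitz.weaken ?_).lipschitzOnWith
    rw [← NNReal.coe_le_coe]
    refine (norm_add_le _ _).trans ?_
    rw [norm_smul]
    exact add_le_add le_rfl (mul_le_mul_of_nonneg_right (hM' t) (norm_nonneg _))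
  have hsol : ∀ t, HasDerivAt (fun t => (φ t, φ' t, v t - B, v' t))
      ((A + q t • C) (φ t, φ' t, v t - B, v' t)) t := by
    intro t
    refine ((h.hasDerivAt t).prodMk ((h.hasDerivAt' t).prodMk
      (((h.hasDerivAt_pot t).sub_const B).prodMk (h.hasDerivAt_pot' t)))).congr_deriv ?_
    have : F c σ α (φ t) = q t * φ t := by
      simp only [F, q]
      ring
    refine Prod.ext ?_ (Prod.ext ?_ (Prod.ext ?_ ?_)) <;>
      simp [A, C, p1, p2, p3, p4, r1, r2, this]
    ring
  have huniq := ODE_solution_unique_univ (t₀ := x₀) (g := fun _ => (0 : ℝ × ℝ × ℝ × ℝ)) hlip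
    (fun t => ⟨hsol t, mem_univ _⟩)
    (fun t => ⟨by rw [map_zero]; exact hasDerivAt_const t 0, mem_univ _⟩)
    (by simp only [h0, h1, h2, h3, sub_self]; rfl)
  exact congrArg Prod.fst (congrFun huniq x)

theorem eq_zero_of_const (h : IsWave c β σ α B φ φ' v v') (hβ : β ≠ 0) {a b m : ℝ} (hab : a < b)
    (hm : ∀ x ∈ Icc a b, φ x = m) (x : ℝ) : φ x = 0 := by
  have cst : ∀ {f f' : ℝ → ℝ} {r : ℝ}, (∀ x, HasDerivAt f (f' x) x) → (∀ x ∈ Ioo a b, f x = r) →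
      ∀ x ∈ Ioo a b, f' x = 0 := fun {f f' r} hf hr x hx =>
    (hf x).unique ((hasDerivAt_const x r).congr_of_eventuallyEq
      (by filter_upwards [Ioo_mem_nhds hx.1 hx.2] with y hy using hr y hy))
  have e0 : ∀ x ∈ Ioo a b, φ x = m := fun x hx => hm x (Ioo_subset_Icc_self hx)
  have e1 := cst h.hasDerivAt e0
  have e2 := cst h.hasDerivAt' e1
  have e3 : ∀ x ∈ Ioo a b, v x = B - F c σ α m := fun x hx => by
    have := e2 x hx
    rw [e0 x hx, div_eq_zero_iff] at this
    linarith [this.resolve_right hβ]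
  have e4 := cst h.hasDerivAt_pot e3
  have e5 := cst h.hasDerivAt_pot' e4
  have hx : (a + b) / 2 ∈ Ioo a b := ⟨by linarith, by linarith⟩
  have m0 : φ ((a + b) / 2) = 0 := neg_eq_zero.1 (e5 _ hx)
  refine h.eq_zero_of_initial m0 (e1 _ hx) ?_ (e4 _ hx) x
  rw [e3 _ hx, ← e0 _ hx, m0]
  simp [F]

end IsWave

/-! ### Maximum principles -/

/-- Strong maximum principle and Hopf lemma for `-g'' = h ≥ 0` with zero boundary values. -/
theorem pos_of_concave {g g' h : ℝ → ℝ} {L : ℝ} (hg : ∀ t, HasDerivAt g (g' t) t)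
    (hg' : ∀ t, HasDerivAt g' (-h t) t) (h0 : g 0 = 0) (hL : g L = 0)
    (hh : ∀ t ∈ Icc 0 L, 0 ≤ h t) {t₀ : ℝ} (ht₀ : t₀ ∈ Ioo 0 L) (hpos : 0 < h t₀) :
    (∀ t ∈ Ioo 0 L, 0 < g t) ∧ 0 < g' 0 := by
  have hLpos : 0 < L := ht₀.1.trans ht₀.2
  have anti : AntitoneOn g' (Icc 0 L) := by
    refine antitoneOn_of_deriv_nonpos (convex_Icc 0 L)
      (fun x _ => (hg' x).continuousAt.continuousWithinAt)
      (fun x _ => (hg' x).differentiableAt.differentiableWithinAt) fun x hx => ?_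
    rw [(hg' x).deriv]
    rw [interior_Icc] at hx
    linarith [hh x (Ioo_subset_Icc_self hx)]
  have gcont : ∀ s, ContinuousOn g s := fun s x _ => (hg x).continuousAt.continuousWithinAt
  have gdiff : ∀ s, DifferentiableOn ℝ g s := fun s x _ =>
    (hg x).differentiableAt.differentiableWithinAt
  have main : ∀ t ∈ Ioo 0 L, 0 < g t := by
    intro t ht
    by_contra! hle
    obtain ⟨p, hp, hp'⟩ := exists_hasDerivAt_eq_slope g g' ht.1 (gcont _) fun x _ => hg x
    obtain ⟨r, hr, hr'⟩ := exists_hasDerivAt_eq_slope g g' ht.2 (gcont _) fun x _ => hg x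
    have hp0 : g' p ≤ 0 := by
      rw [hp', h0]
      exact div_nonpos_of_nonpos_of_nonneg (by linarith) (by linarith [ht.1])
    have hr0 : 0 ≤ g' r := by
      rw [hr', hL]
      exact div_nonneg (by linarith) (by linarith [ht.2])
    -- As `g'` is decreasing, `g` increases up to `t` and decreases from `t` on; hence `g = 0`.
    have mono : MonotoneOn g (Icc 0 t) := by
      refine monotoneOn_of_deriv_nonneg (convex_Icc 0 t) (gcont _) (gdiff _) fun x hx => ?_
      rw [(hg x).deriv]
      rw [interior_Icc] at hx
      exact hr0.trans (anti ⟨hx.1.le, by linarith [hx.2, ht.2]⟩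
        ⟨by linarith [ht.1, hr.1], hr.2.le⟩ (by linarith [hx.2, hr.1]))
    have anti' : AntitoneOn g (Icc t L) := by
      refine antitoneOn_of_deriv_nonpos (convex_Icc t L) (gcont _) (gdiff _) fun x hx => ?_
      rw [(hg x).deriv]
      rw [interior_Icc] at hx
      exact (anti ⟨hp.1.le, by linarith [hp.2, ht.2]⟩
        ⟨by linarith [ht.1, hx.1], hx.2.le⟩ (by linarith [hx.1, hp.2])).trans hp0
    have hz : ∀ x ∈ Ioo 0 L, g x = 0 := by
      intro x hx
      rcases le_total x t with hxt | hxt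
      · have a1 := mono ⟨le_rfl, ht.1.le⟩ ⟨hx.1.le, hxt⟩ hx.1.le
        have a2 := mono ⟨hx.1.le, hxt⟩ ⟨ht.1.le, le_rfl⟩ hxt
        linarith
      · have a0 := mono ⟨le_rfl, ht.1.le⟩ ⟨ht.1.le, le_rfl⟩ ht.1.le
        have a1 := anti' ⟨le_rfl, ht.2.le⟩ ⟨hxt, hx.2.le⟩ hxt
        have a2 := anti' ⟨hxt, hx.2.le⟩ ⟨ht.2.le, le_rfl⟩ hx.2.le
        linarith
    have hz' : ∀ x ∈ Ioo 0 L, g' x = 0 := fun x hx =>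
      (hg x).unique ((hasDerivAt_const x 0).congr_of_eventuallyEq
        (by filter_upwards [Ioo_mem_nhds hx.1 hx.2] with y hy using hz y hy))
    have := (hg' t₀).unique ((hasDerivAt_const t₀ 0).congr_of_eventuallyEq
        (by filter_upwards [Ioo_mem_nhds ht₀.1 ht₀.2] with y hy using hz' y hy))
    linarith
  refine ⟨main, ?_⟩
  by_contra! hle
  have anti' : AntitoneOn g (Icc 0 L) := by
    refine antitoneOn_of_deriv_nonpos (convex_Icc 0 L) (gcont _) (gdiff _) fun x hx => ?_
    rw [(hg x).deriv]
    rw [interior_Icc] at hx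
    exact (anti ⟨le_rfl, hLpos.le⟩ (Ioo_subset_Icc_self hx) hx.1.le).trans hle
  have := anti' ⟨le_rfl, hLpos.le⟩ (Ioo_subset_Icc_self ht₀) ht₀.1.le
  linarith [main t₀ ht₀]

/-- A function that is nonnegative to the right of a zero cannot vanish to second order there with
a negative third derivative. -/
theorem deriv_ne_zero_of_third_deriv_neg {f f' f'' : ℝ → ℝ} {L d : ℝ} (hL : 0 < L)
    (hf : ∀ t, HasDerivAt f (f' t) t) (hf' : ∀ t, HasDerivAt f' (f'' t) t)
    (hf'' : HasDerivAt f'' d 0) (hd : d < 0) (h0 : f 0 = 0) (h2 : f'' 0 = 0)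
    (hnn : ∀ t ∈ Icc 0 L, 0 ≤ f t) : f' 0 ≠ 0 := by
  intro h1
  have hev : ∀ᶠ t in 𝓝[>] (0 : ℝ), f'' t < 0 := by
    have := (hasDerivAt_iff_tendsto_slope.1 hf'').mono_left
      (nhdsWithin_mono 0 fun t (ht : (0 : ℝ) < t) => ht.ne')
    filter_upwards [this.eventually_lt_const hd, self_mem_nhdsWithin] with t ht htpos
    rw [slope_def_field, h2, sub_zero, sub_zero] at ht
    exact (div_neg_iff.1 ht).elim (fun h => absurd h.2 (not_lt.2 (le_of_lt htpos))) fun h => h.1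
  obtain ⟨δ, hδ, hδ'⟩ := mem_nhdsGT_iff_exists_Ioo_subset.1 hev
  set r := min (δ / 2) L with hr
  have hδ0 : 0 < δ := hδ
  have hr0 : 0 < r := lt_min (by linarith) hL
  have hrδ : r < δ := (min_le_left _ _).trans_lt (by linarith)
  have anti' : StrictAntiOn f' (Icc 0 r) := by
    refine strictAntiOn_of_deriv_neg (convex_Icc 0 r)
      (fun x _ => (hf' x).continuousAt.continuousWithinAt) fun x hx => ?_
    rw [(hf' x).deriv]
    rw [interior_Icc] at hx
    exact hδ' ⟨hx.1, hx.2.trans hrδ⟩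
  have anti : StrictAntiOn f (Icc 0 r) := by
    refine strictAntiOn_of_deriv_neg (convex_Icc 0 r)
      (fun x _ => (hf x).continuousAt.continuousWithinAt) fun x hx => ?_
    rw [(hf x).deriv]
    rw [interior_Icc] at hx
    rw [← h1]
    exact anti' ⟨le_rfl, hr0.le⟩ (Ioo_subset_Icc_self hx) hx.1
  have := anti ⟨le_rfl, hr0.le⟩ ⟨hr0.le, le_rfl⟩ hr0
  linarith [hnn r ⟨hr0.le, min_le_right _ _⟩]

/-! ### Symmetry by the method of moving planes -/

/-- The reflection of `φ` about `l` lies below `φ` on the half period to the right of `l`. -/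
def DominatesReflection (φ : ℝ → ℝ) (l : ℝ) : Prop :=
  ∀ t ∈ Icc 0 π, φ (l - t) ≤ φ (l + t)

theorem symmetric_of_eqOn_half {φ : ℝ → ℝ} (hp : Function.Periodic φ (2 * π)) {l : ℝ}
    (h : ∀ t ∈ Icc 0 π, φ (l - t) = φ (l + t)) : Symmetric φ := by
  refine ⟨l, fun x => ?_⟩
  have hu : Function.Periodic (fun t => φ (l - t) - φ (l + t)) (2 * π) := fun t => by
    have h1 := hp (l - (t + 2 * π))
    have h2 := hp (l + t)
    rw [sub_add_eq_sub_sub, sub_add_cancel] at h1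
    simp only [sub_add_eq_sub_sub, ← add_assoc, h1, h2]
  obtain ⟨y, hy, hxy⟩ := hu.exists_mem_Ico two_pi_pos (x - l) (-π)
  have e : φ (l - y) = φ (l + y) := by
    rcases le_total 0 y with h0 | h0
    · exact h y ⟨h0, by linarith [hy.2]⟩
    · have := h (-y) ⟨by linarith, by linarith [hy.1]⟩
      rw [sub_neg_eq_add, ← sub_eq_add_neg] at this
      exact this.symm
  simp only [e, sub_self] at hxy
  have e1 : l - (x - l) = 2 * l - x := by ring
  have e2 : l + (x - l) = x := by ring
  rw [e1, e2] at hxy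
  linarith

namespace IsWave

variable {c β σ α B : ℝ} {φ φ' v v' : ℝ → ℝ}

/-- If `φ` dominates its reflection about `l` without being symmetric, it does so strictly, and its
graph is transversal to the reflected one at `l`: the difference `h` satisfies
`β h'' + q h = -g < 0`, where `-g'' = h`. -/
theorem strict_of_dominates (h : IsWave c β σ α B φ φ' v v') (hβ : 0 < β) {l : ℝ}
    (hl : DominatesReflection φ l) {t₀ : ℝ} (ht₀ : t₀ ∈ Icc 0 π)
    (hlt : φ (l - t₀) < φ (l + t₀)) :
    (∀ t ∈ Ioo 0 π, φ (l - t) < φ (l + t)) ∧ 0 < φ' l := by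
  have odd : ∀ {f f' : ℝ → ℝ}, (∀ x, HasDerivAt f (f' x) x) →
      ∀ t, HasDerivAt (fun t => f (l + t) - f (l - t)) (f' (l + t) + f' (l - t)) t :=
    fun {f f'} hf t => by
      have h1 := (hf (l + t)).comp t ((hasDerivAt_id t).const_add l)
      have h2 := (hf (l - t)).comp t ((hasDerivAt_id t).const_sub l)
      exact (h1.sub h2).congr_deriv (by ring)
  have even : ∀ {f f' : ℝ → ℝ}, (∀ x, HasDerivAt f (f' x) x) →
      ∀ t, HasDerivAt (fun t => f (l + t) + f (l - t)) (f' (l + t) - f' (l - t)) t :=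
    fun {f f'} hf t => by
      have h1 := (hf (l + t)).comp t ((hasDerivAt_id t).const_add l)
      have h2 := (hf (l - t)).comp t ((hasDerivAt_id t).const_sub l)
      exact (h1.add h2).congr_deriv (by ring)
  have ends : ∀ {f : ℝ → ℝ}, Function.Periodic f (2 * π) → f (l + π) = f (l - π) := fun hf => by
    rw [← hf (l - π)]
    congr 1
    ring
  have dh := odd h.hasDerivAt
  have dh' := even h.hasDerivAt'
  have dg := odd h.hasDerivAt_pot
  have dg' := even h.hasDerivAt_pot'
  have ht₀' : t₀ ∈ Ioo 0 π := by
    refine ⟨lt_of_le_of_ne ht₀.1 ?_, lt_of_le_of_ne ht₀.2 ?_⟩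
    · rintro rfl
      simp at hlt
    · rintro rfl
      rw [ends h.periodic] at hlt
      exact hlt.false
  obtain ⟨gpos, g0⟩ := pos_of_concave (L := π) (h := fun t => φ (l + t) - φ (l - t)) dg
    (fun t => (dg' t).congr_deriv (by ring)) (by simp) (by simp [ends h.periodic_pot])
    (fun t ht => sub_nonneg.2 (hl t ht)) ht₀' (sub_pos.2 hlt)
  simp only [add_zero, sub_zero] at g0
  constructor
  · intro t ht
    refine lt_of_le_of_ne (hl t (Ioo_subset_Icc_self ht)) fun heq => ?_
    have hnn : ∀ᶠ s in 𝓝 t, φ (l + t) - φ (l - t) ≤ φ (l + s) - φ (l - s) := by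
      filter_upwards [Ioo_mem_nhds ht.1 ht.2] with s hs
      rw [heq, sub_self]
      exact sub_nonneg.2 (hl s (Ioo_subset_Icc_self hs))
    have h1 : φ' (l + t) + φ' (l - t) = 0 := by
      have hmin : IsLocalMin (fun t => φ (l + t) - φ (l - t)) t := hnn
      exact hmin.hasDerivAt_eq_zero (dh t)
    have h2 := ge_of_tendsto (b := 0) (tendsto_div_sq dh (dh' t) h1) (by
      filter_upwards [hnn.filter_mono nhdsWithin_le_nhds] with s hs
      exact div_nonneg (sub_nonneg.2 hs) (sq_nonneg _))
    have h3 : -(F c σ α (φ (l + t)) + v (l + t) - B) / β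
        - -(F c σ α (φ (l - t)) + v (l - t) - B) / β = -(v (l + t) - v (l - t)) / β := by
      rw [heq]
      ring
    rw [h3] at h2
    have := div_pos (gpos t ht) hβ
    rw [neg_div] at h2
    linarith
  · have hge : 0 ≤ φ' (l + 0) + φ' (l - 0) := by
      have hle : 𝓝[>] (0 : ℝ) ≤ 𝓝[≠] 0 := nhdsWithin_mono 0 fun t (ht : (0 : ℝ) < t) => ht.ne'
      have := (hasDerivAt_iff_tendsto_slope.1 (dh 0)).mono_left hle
      refine ge_of_tendsto this ?_
      filter_upwards [Ioo_mem_nhdsGT pi_pos] with t ht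
      rw [slope_def_field]
      simp only [add_zero, sub_zero, sub_self]
      exact div_nonneg (sub_nonneg.2 (hl t (Ioo_subset_Icc_self ht))) ht.1.le
    rw [add_zero, sub_zero] at hge
    refine lt_of_le_of_ne (by linarith) fun h0 => ?_
    have hF : ∀ x, HasDerivAt (fun x => -(F c σ α (φ x) + v x - B) / β)
        (-((-c + σ * φ x + α * φ x ^ 2) * φ' x + v' x) / β) x := fun x =>
      ((((hasDerivAt_F c σ α (φ x)).comp x (h.hasDerivAt x)).add
        (h.hasDerivAt_pot x)).sub_const B).neg.div_const β
    -- If `φ' l = 0`, then `β h''' = -g' < 0` at the axis, where `h`, `h'` and `h''` vanish.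
    refine deriv_ne_zero_of_third_deriv_neg pi_pos dh dh' (odd hF 0) ?_ (by simp) (by simp)
      (fun t ht => sub_nonneg.2 (hl t ht)) (by simp [← h0])
    simp only [add_zero, sub_zero, ← h0, mul_zero, zero_add]
    rw [← add_div, div_neg_iff]
    exact Or.inr ⟨by linarith, hβ⟩

theorem deriv_neg_of_dominates (h : IsWave c β σ α B φ φ' v v') (hβ : 0 < β) {l : ℝ}
    (hl : DominatesReflection φ l) {t₀ : ℝ} (ht₀ : t₀ ∈ Icc 0 π)
    (hlt : φ (l - t₀) < φ (l + t₀)) : φ' (l + π) < 0 := by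
  have e1 : ∀ t, φ (-(-(l + π) + t)) = φ (l + (π - t)) := fun t => by
    congr 1
    ring
  have e2 : ∀ t, φ (-(-(l + π) - t)) = φ (l - (π - t)) := fun t => by
    rw [← h.periodic (l - (π - t))]
    congr 1
    ring
  have := (h.reflect.strict_of_dominates (l := -(l + π)) hβ
    (fun t ht => by
      simp only [e1, e2]
      exact hl (π - t) ⟨by linarith [ht.2], by linarith [ht.1]⟩)
    (t₀ := π - t₀) ⟨by linarith [ht₀.2], by linarith [ht₀.1]⟩
    (by
      simp only [e1, e2, sub_sub_cancel]
      exact hlt)).2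
  rw [neg_neg] at this
  linarith

/-- Strict domination persists under small shifts of the axis of reflection. -/
theorem eventually_dominates (h : IsWave c β σ α B φ φ' v v') {l : ℝ}
    (hpos : ∀ t ∈ Ioo 0 π, φ (l - t) < φ (l + t)) (h0 : 0 < φ' l) (hπ : φ' (l + π) < 0) :
    ∀ᶠ m in 𝓝 l, DominatesReflection φ m := by
  obtain ⟨r₁, hr₁, H₁⟩ := Metric.eventually_nhds_iff_ball.1
    (h.continuous'.continuousAt.eventually_const_lt h0)
  obtain ⟨r₂, hr₂, H₂⟩ := Metric.eventually_nhds_iff_ball.1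
    (h.continuous'.continuousAt.eventually_lt_const hπ)
  set r := min r₁ r₂ / 2 with hr
  have hr0 : 0 < r := half_pos (lt_min hr₁ hr₂)
  have hr1 : 2 * r ≤ r₁ := by linarith [min_le_left r₁ r₂]
  have hr2 : 2 * r ≤ r₂ := by linarith [min_le_right r₁ r₂]
  rw [Real.ball_eq_Ioo] at H₁ H₂
  have mono : MonotoneOn φ (Ioo (l - r₁) (l + r₁)) :=
    monotoneOn_of_deriv_nonneg (convex_Ioo _ _) h.continuous.continuousOn
      (fun x _ => (h.hasDerivAt x).differentiableAt.differentiableWithinAt) fun x hx => by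
        rw [(h.hasDerivAt x).deriv]
        exact (H₁ x (interior_subset hx)).le
  have anti : AntitoneOn φ (Ioo (l + π - r₂) (l + π + r₂)) :=
    antitoneOn_of_deriv_nonpos (convex_Ioo _ _) h.continuous.continuousOn
      (fun x _ => (h.hasDerivAt x).differentiableAt.differentiableWithinAt) fun x hx => by
        rw [(h.hasDerivAt x).deriv]
        exact (H₂ x (interior_subset hx)).le
  have hmid : ∀ᶠ m in 𝓝 l, ∀ t ∈ Icc r (π - r), φ (m - t) < φ (m + t) := by
    refine isCompact_Icc.eventually_forall_of_forall_eventually fun t ht => ?_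
    have hc := h.continuous
    have c1 : Continuous fun z : ℝ × ℝ => φ (z.1 - z.2) := by fun_prop
    have c2 : Continuous fun z : ℝ × ℝ => φ (z.1 + z.2) := by fun_prop
    exact c1.continuousAt.eventually_lt c2.continuousAt
      (hpos t ⟨by linarith [ht.1], by linarith [ht.2]⟩)
  filter_upwards [hmid, Ioo_mem_nhds (show l - r < l by linarith) (show l < l + r by linarith)]
    with m hm hml t ht
  rcases lt_or_ge t r with htr | htr
  · exact mono ⟨by linarith [hml.1], by linarith [hml.2, ht.1]⟩
      ⟨by linarith [hml.1, ht.1], by linarith [hml.2]⟩ (by linarith [ht.1])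
  rcases lt_or_ge (π - r) t with htr' | htr'
  · rw [← h.periodic (m - t)]
    exact anti ⟨by linarith [hml.1], by linarith [hml.2, ht.2]⟩
      ⟨by linarith [hml.1, ht.2], by linarith [hml.2]⟩ (by linarith [ht.2])
  · exact (hm t ⟨htr, htr'⟩).le

/-- Moving the axis of reflection from `l` to `l + π` reverses the roles of `φ` and its reflection,
so that the two coincide for the last axis about which `φ` dominates its reflection. -/
theorem symmetric_of_dominates (h : IsWave c β σ α B φ φ' v v') (hβ : 0 < β) {l : ℝ}
    (hl : DominatesReflection φ l) : Symmetric φ := by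
  have hc := h.continuous
  have hS : IsCompact (Icc l (l + π) ∩ {m | DominatesReflection φ m}) := by
    refine isCompact_Icc.inter_right ?_
    simp only [DominatesReflection, ofPred_forall]
    refine isClosed_biInter fun t _ => isClosed_le ?_ ?_ <;> fun_prop
  obtain ⟨m, ⟨hm1, hm2⟩, hm3⟩ := hS.exists_isGreatest ⟨l, ⟨le_rfl, by linarith [pi_pos]⟩, hl⟩
  by_cases hex : ∃ t ∈ Icc 0 π, φ (m - t) < φ (m + t)
  · obtain ⟨t, ht, hlt⟩ := hex
    -- About `l + π`, `φ` dominates its reflection as well as conversely.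
    rcases eq_or_lt_of_le hm1.2 with rfl | hlt'
    · have := hl (π - t) ⟨by linarith [ht.2], by linarith [ht.1]⟩
      have e1 : φ (l - (π - t)) = φ (l + π + t) := by
        rw [← h.periodic (l - (π - t))]
        congr 1
        ring
      have e2 : l + (π - t) = l + π - t := by ring
      rw [e1, e2] at this
      linarith
    · obtain ⟨hs, h0⟩ := h.strict_of_dominates hβ hm2 ht hlt
      have hev := h.eventually_dominates hs h0 (h.deriv_neg_of_dominates hβ hm2 ht hlt)
      obtain ⟨p, hp1, hp2⟩ := ((hev.filter_mono nhdsWithin_le_nhds).and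
        (Ioo_mem_nhdsGT hlt')).exists
      have := hm3 ⟨⟨by linarith [hm1.1, hp2.1], hp2.2.le⟩, hp1⟩
      exact absurd hp2.1 (not_lt.2 this)
  · push Not at hex
    exact symmetric_of_eqOn_half h.periodic fun t ht => le_antisymm (hm2 t ht) (hex t ht)

/-- A single-crested profile takes equal values at two points at distance half a period; the crest
lies on one side of them, the trough on the other. -/
theorem symmetric_of_singleCrest (h : IsWave c β σ α B φ φ' v v') (hβ : 0 < β)
    (hs : SingleCrest φ) : Symmetric φ := by
  obtain ⟨x₀, x₁, h01, h12, mono, anti⟩ := hs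
  have hc := h.continuous
  have hx₀ : φ x₀ ≤ φ (x₀ + π) := by
    rcases le_total (x₀ + π) x₁ with hle | hle
    · exact mono ⟨le_rfl, h01.le⟩ ⟨by linarith [pi_pos], hle⟩ (by linarith [pi_pos])
    · rw [← h.periodic x₀]
      exact anti ⟨hle, by linarith [pi_pos]⟩ ⟨h12.le, le_rfl⟩ (by linarith [pi_pos])
  have e : φ (x₀ + π + π) = φ x₀ := by
    rw [← h.periodic x₀]
    congr 1
    ring
  obtain ⟨l, hl, hl0⟩ := intermediate_value_Icc (a := x₀) (b := x₀ + π)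
    (f := fun x => φ x - φ (x + π)) (by linarith [pi_pos]) (by fun_prop)
    (show (0 : ℝ) ∈ Icc _ _ from ⟨by linarith, by linarith⟩)
  have heq : φ l = φ (l + π) := sub_eq_zero.1 hl0
  have hπ := pi_pos
  -- If `l` and `l + π` lie on the same side of the crest, then `φ` is constant between them.
  rcases lt_or_ge x₁ l with hx | hx
  · have hz := h.eq_zero_of_const hβ.ne' (a := l) (b := l + π) (m := φ l) (by linarith)
      fun x hx' => le_antisymm
        (anti ⟨hx.le, by linarith [hl.2]⟩ ⟨by linarith [hx'.1], by linarith [hx'.2, hl.2]⟩ hx'.1)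
        (heq.le.trans (anti ⟨by linarith [hx'.1], by linarith [hx'.2, hl.2]⟩
          ⟨by linarith, by linarith [hl.2]⟩ hx'.2))
    exact ⟨0, fun x => by rw [hz, hz]⟩
  rcases lt_or_ge (l + π) x₁ with hx2 | hx2
  · have hz := h.eq_zero_of_const hβ.ne' (a := l) (b := l + π) (m := φ l) (by linarith)
      fun x hx' => le_antisymm
        ((mono ⟨by linarith [hx'.1, hl.1], by linarith [hx'.2]⟩
          ⟨by linarith [hl.1], hx2.le⟩ hx'.2).trans heq.ge)
        (mono ⟨hl.1, hx⟩ ⟨by linarith [hx'.1, hl.1], by linarith [hx'.2]⟩ hx'.1)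
    exact ⟨0, fun x => by rw [hz, hz]⟩
  refine h.symmetric_of_dominates hβ (l := l) fun t ht => ?_
  have hge : φ l ≤ φ (l + t) := by
    rcases le_total (l + t) x₁ with hle | hle
    · exact mono ⟨hl.1, hx⟩ ⟨by linarith [hl.1, ht.1], hle⟩ (by linarith [ht.1])
    · rw [heq]
      exact anti ⟨hle, by linarith [ht.2, hl.2]⟩ ⟨hx2, by linarith [hl.2]⟩ (by linarith [ht.2])
  refine le_trans ?_ hge
  rcases le_total x₀ (l - t) with hle | hle
  · exact mono ⟨hle, by linarith [ht.1]⟩ ⟨hl.1, hx⟩ (by linarith [ht.1])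
  · rw [heq, ← h.periodic (l - t)]
    exact anti ⟨hx2, by linarith [hl.2]⟩ ⟨by linarith [ht.2], by linarith⟩ (by linarith [ht.2])

end IsWave

/-! ### Trigonometric series -/

/-- The cosine series with coefficients `r`. -/
def cosSeries (r : ℕ → ℝ) (x : ℝ) : ℝ := ∑' k : ℕ, r k * cos (k * x)

/-- The sine series with coefficients `r`. -/
def sinSeries (r : ℕ → ℝ) (x : ℝ) : ℝ := ∑' k : ℕ, r k * sin (k * x)

theorem hasSum_cosSeries {r : ℕ → ℝ} (hr : Summable fun k => |r k|) (x : ℝ) :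
    HasSum (fun k : ℕ => r k * cos (k * x)) (cosSeries r x) :=
  (Summable.of_norm_bounded hr fun k => by
    rw [norm_mul]
    exact mul_le_of_le_one_right (norm_nonneg _) (abs_cos_le_one _)).hasSum

theorem hasSum_sinSeries {r : ℕ → ℝ} (hr : Summable fun k => |r k|) (x : ℝ) :
    HasSum (fun k : ℕ => r k * sin (k * x)) (sinSeries r x) :=
  (Summable.of_norm_bounded hr fun k => by
    rw [norm_mul]
    exact mul_le_of_le_one_right (norm_nonneg _) (abs_sin_le_one _)).hasSum

theorem abs_cosSeries_le {r : ℕ → ℝ} (hr : Summable fun k => |r k|) (x : ℝ) :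
    |cosSeries r x| ≤ ∑' k, |r k| :=
  tsum_of_norm_bounded (f := fun k : ℕ => r k * cos (k * x)) hr.hasSum fun k => by
    rw [norm_mul]
    exact mul_le_of_le_one_right (norm_nonneg _) (abs_cos_le_one _)

theorem abs_sinSeries_le {r : ℕ → ℝ} (hr : Summable fun k => |r k|) (x : ℝ) :
    |sinSeries r x| ≤ ∑' k, |r k| :=
  tsum_of_norm_bounded (f := fun k : ℕ => r k * sin (k * x)) hr.hasSum fun k => by
    rw [norm_mul]
    exact mul_le_of_le_one_right (norm_nonneg _) (abs_sin_le_one _)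

theorem hasDerivAt_cosSeries {r : ℕ → ℝ} (hr : Summable fun k => |r k|)
    (hr' : Summable fun k : ℕ => |k * r k|) (x : ℝ) :
    HasDerivAt (cosSeries r) (-sinSeries (fun k => k * r k) x) x := by
  have := hasDerivAt_tsum (g := fun (k : ℕ) x => r k * cos (k * x))
    (g' := fun (k : ℕ) x => -(k * r k * sin (k * x))) hr' (fun k y => by
      refine (((hasDerivAt_id y).const_mul (k : ℝ)).cos.const_mul (r k)).congr_deriv ?_
      simp
      ring) (fun k y => by
      rw [norm_neg, norm_mul]
      exact mul_le_of_le_one_right (norm_nonneg _) (abs_sin_le_one _))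
    (hasSum_cosSeries hr 0).summable x
  rwa [tsum_neg] at this

theorem hasDerivAt_sinSeries {r : ℕ → ℝ} (hr : Summable fun k => |r k|)
    (hr' : Summable fun k : ℕ => |k * r k|) (x : ℝ) :
    HasDerivAt (sinSeries r) (cosSeries (fun k => k * r k) x) x :=
  hasDerivAt_tsum (g := fun (k : ℕ) x => r k * sin (k * x))
    (g' := fun (k : ℕ) x => k * r k * cos (k * x)) hr' (fun k y => by
      refine (((hasDerivAt_id y).const_mul (k : ℝ)).sin.const_mul (r k)).congr_deriv ?_
      simp
      ring) (fun k y => by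
      rw [norm_mul]
      exact mul_le_of_le_one_right (norm_nonneg _) (abs_cos_le_one _))
    (hasSum_sinSeries hr 0).summable x

theorem periodic_cosSeries (r : ℕ → ℝ) : Function.Periodic (cosSeries r) (2 * π) := fun x => by
  simp only [cosSeries, mul_add, cos_add_nat_mul_two_pi]

theorem periodic_sinSeries (r : ℕ → ℝ) : Function.Periodic (sinSeries r) (2 * π) := fun x => by
  simp only [sinSeries, mul_add, sin_add_nat_mul_two_pi]

theorem cosSeries_neg (r : ℕ → ℝ) (x : ℝ) : cosSeries r (-x) = cosSeries r x := by
  simp only [cosSeries, mul_neg, cos_neg]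

theorem sinSeries_pi (r : ℕ → ℝ) : sinSeries r π = 0 := by
  simp only [sinSeries, sin_nat_mul_pi, mul_zero, tsum_zero]

theorem sinSeries_neg_pi (r : ℕ → ℝ) : sinSeries r (-π) = 0 := by
  simp only [sinSeries, mul_neg, sin_neg, sin_nat_mul_pi, neg_zero, mul_zero, tsum_zero]

theorem continuous_cosSeries {r : ℕ → ℝ} (hr : Summable fun k => |r k|) :
    Continuous (cosSeries r) :=
  continuous_tsum (fun k => by fun_prop) hr fun k x => by
    rw [norm_mul]
    exact mul_le_of_le_one_right (norm_nonneg _) (abs_cos_le_one _)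

/-- A cosine series without constant term has zero mean. -/
theorem integral_cosSeries {r : ℕ → ℝ} (hr : Summable fun k => |r k|) (h0 : r 0 = 0) :
    ∫ x in (-π)..π, cosSeries r x = 0 := by
  have e : r = fun k : ℕ => k * (r k / k) := funext fun k => by
    rcases Nat.eq_zero_or_pos k with rfl | hk
    · simp [h0]
    · have : (k : ℝ) ≠ 0 := by exact_mod_cast hk.ne'
      field_simp
  have hr' : Summable fun k : ℕ => |r k / k| := by
    refine Summable.of_nonneg_of_le (fun k => abs_nonneg _) (fun k => ?_) hr
    rw [abs_div, Nat.abs_cast]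
    rcases Nat.eq_zero_or_pos k with rfl | hk
    · simp
    · exact div_le_self (abs_nonneg _) (by exact_mod_cast hk)
  rw [intervalIntegral.integral_eq_sub_of_hasDerivAt (f := sinSeries fun k => r k / k)
    (fun x _ => ?_) ((continuous_cosSeries hr).intervalIntegrable _ _), sinSeries_pi,
    sinSeries_neg_pi, sub_zero]
  have := hasDerivAt_sinSeries hr' (by rwa [e] at hr) x
  rwa [← e] at this

/-! ### A Banach algebra of cosine series -/

/-- The space `ℓ¹` of coefficients of cosine series. -/
abbrev Coeff : Type := lp (fun _ : ℕ => ℝ) 1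

/-- The weight for the coefficients: `b ∈ ℓ¹` stands for the function `∑ b k cos (k x) / (1 + k)²`,
which is of class `C²`. -/
def weight (k : ℕ) : ℝ := (1 + k) ^ 2

theorem weight_pos (k : ℕ) : 0 < weight k := by
  unfold weight
  positivity

namespace Coeff

theorem hasSum_abs (b : Coeff) : HasSum (fun k => |b k|) ‖b‖ := by
  have := lp.hasSum_norm (p := 1) (by simp) b
  simpa using this

/-- The unit sequences. -/
def basis (k : ℕ) : Coeff := lp.single 1 k (1 : ℝ)

theorem basis_apply (k j : ℕ) : basis k j = if j = k then 1 else 0 := by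
  rw [basis, lp.single_apply, Pi.single_apply]

theorem norm_basis (k : ℕ) : ‖basis k‖ = 1 := by
  rw [basis, lp.norm_single (by simp), norm_one]

variable {Z Y : Type*} [NormedAddCommGroup Z] [NormedSpace ℝ Z] [CompleteSpace Z]
  [NormedAddCommGroup Y] [NormedSpace ℝ Y]

theorem summable_smul {z : ℕ → Z} {C : ℝ} (hz : ∀ k, ‖z k‖ ≤ C) (b : Coeff) :
    Summable fun k => b k • z k :=
  Summable.of_norm_bounded (b.hasSum_abs.summable.mul_right C) fun k => by
    rw [norm_smul]
    exact mul_le_mul_of_nonneg_left (hz k) (norm_nonneg _)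

/-- The universal property of `ℓ¹`: the continuous linear map with prescribed bounded values on the
unit sequences. -/
def lift (z : ℕ → Z) (C : ℝ) (hz : ∀ k, ‖z k‖ ≤ C) : Coeff →L[ℝ] Z :=
  LinearMap.mkContinuous
    { toFun := fun b => ∑' k, b k • z k
      map_add' := fun a b => by
        rw [← (summable_smul hz a).tsum_add (summable_smul hz b)]
        simp only [lp.coeFn_add, Pi.add_apply, add_smul]
      map_smul' := fun r b => by
        rw [RingHom.id_apply, ← (summable_smul hz b).tsum_const_smul]
        simp only [lp.coeFn_smul, Pi.smul_apply, smul_assoc] }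
    C fun b => by
      rw [mul_comm]
      refine tsum_of_norm_bounded (b.hasSum_abs.mul_right C) fun k => ?_
      rw [norm_smul]
      exact mul_le_mul_of_nonneg_left (hz k) (norm_nonneg _)

theorem lift_apply (z : ℕ → Z) (C : ℝ) (hz : ∀ k, ‖z k‖ ≤ C) (b : Coeff) :
    lift z C hz b = ∑' k, b k • z k := rfl

theorem map_lift (z : ℕ → Z) (C : ℝ) (hz : ∀ k, ‖z k‖ ≤ C) (L : Z →L[ℝ] Y) (b : Coeff) :
    L (lift z C hz b) = ∑' k, b k • L (z k) := by
  rw [lift_apply, L.map_tsum (summable_smul hz b)]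
  simp only [map_smul]

theorem norm_lift_le (z : ℕ → Z) (C : ℝ) (hz : ∀ k, ‖z k‖ ≤ C) : ‖lift z C hz‖ ≤ C :=
  LinearMap.mkContinuous_norm_le _ ((norm_nonneg _).trans (hz 0)) _

/-- The coordinate functionals. -/
def coord (k : ℕ) : Coeff →L[ℝ] ℝ := lp.evalCLM ℝ (fun _ : ℕ => ℝ) 1 k

theorem coord_apply (k : ℕ) (b : Coeff) : coord k b = b k := rfl

/-- The diagonal operator with bounded multiplier `m`. -/
def diag (m : ℕ → ℝ) (C : ℝ) (hm : ∀ k, |m k| ≤ C) : Coeff →L[ℝ] Coeff :=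
  lift (fun k => m k • basis k) C fun k => by
    rw [norm_smul, norm_basis, mul_one]
    exact hm k

theorem diag_apply (m : ℕ → ℝ) (C : ℝ) (hm : ∀ k, |m k| ≤ C) (b : Coeff) (k : ℕ) :
    diag m C hm b k = m k * b k := by
  rw [← coord_apply, diag, map_lift, tsum_eq_single k fun j hj => ?_]
  · rw [map_smul, coord_apply, basis_apply, if_pos rfl, smul_eq_mul, smul_eq_mul]
    ring
  · rw [map_smul, coord_apply, basis_apply, if_neg hj.symm, smul_zero, smul_zero]

theorem norm_eval_le (x : ℝ) (k : ℕ) : ‖cos (k * x) / weight k‖ ≤ 1 := by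
  rw [norm_div, Real.norm_of_nonneg (weight_pos k).le, div_le_one (weight_pos k)]
  refine (abs_cos_le_one _).trans ?_
  unfold weight
  nlinarith [Nat.cast_nonneg (α := ℝ) k]

/-- The value at `x` of the function `∑ b k cos (k x) / (1 + k)²`. -/
def eval (x : ℝ) : Coeff →L[ℝ] ℝ :=
  lift (fun k => cos (k * x) / weight k) 1 (norm_eval_le x)

theorem eval_eq_cosSeries (x : ℝ) (b : Coeff) :
    eval x b = cosSeries (fun k => b k / weight k) x := by
  rw [eval, lift_apply, cosSeries]
  refine tsum_congr fun k => ?_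
  rw [smul_eq_mul]
  ring

/-- The product of two unit sequences, according to
`2 cos (i x) cos (j x) = cos ((i + j) x) + cos ((i - j) x)`. (One of the truncated differences
`i - j`, `j - i` vanishes, and their sum is `|i - j|`.) -/
def mulBasis (i j : ℕ) : Coeff :=
  (weight (i + j) / (2 * (weight i * weight j))) • basis (i + j)
    + (weight (i - j + (j - i)) / (2 * (weight i * weight j))) • basis (i - j + (j - i))

theorem norm_mulBasis_le (i j : ℕ) : ‖mulBasis i j‖ ≤ 1 := by
  have hi := weight_pos i
  have hj := weight_pos j
  have h : ∀ n : ℕ, n ≤ i + j → weight n / (2 * (weight i * weight j)) ≤ 1 / 2 := fun n hn => by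
    rw [div_le_iff₀ (by positivity)]
    have hn' : (n : ℝ) ≤ i + j := by exact_mod_cast hn
    have h1 : (1 + n : ℝ) ≤ (1 + i) * (1 + j) := by
      nlinarith [mul_nonneg (Nat.cast_nonneg (α := ℝ) i) (Nat.cast_nonneg (α := ℝ) j)]
    have h2 : weight n ≤ weight i * weight j := by
      rw [weight, weight, weight, ← mul_pow]
      exact pow_le_pow_left₀ (by positivity) h1 2
    linarith
  have h' : ∀ n : ℕ, n ≤ i + j →
      ‖(weight n / (2 * (weight i * weight j))) • basis n‖ ≤ 1 / 2 := fun n hn => by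
    rw [norm_smul, norm_basis, mul_one, Real.norm_of_nonneg]
    · exact h n hn
    · have := weight_pos n
      positivity
  refine (norm_add_le _ _).trans ((add_le_add (h' _ le_rfl) (h' _ (by omega))).trans ?_)
  norm_num

theorem eval_basis (x : ℝ) (k : ℕ) : eval x (basis k) = cos (k * x) / weight k := by
  rw [eval, lift_apply, tsum_eq_single k fun j hj => by rw [basis_apply, if_neg hj, zero_smul],
    basis_apply, if_pos rfl, one_smul]

theorem eval_mulBasis (x : ℝ) (i j : ℕ) :
    eval x (mulBasis i j) = cos (i * x) / weight i * (cos (j * x) / weight j) := by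
  have hcos : cos (((i - j + (j - i) : ℕ) : ℝ) * x) = cos (i * x - j * x) := by
    rcases le_total i j with h | h
    · rw [Nat.sub_eq_zero_of_le h, zero_add, Nat.cast_sub h, ← cos_neg]
      congr 1
      ring
    · rw [Nat.sub_eq_zero_of_le h, add_zero, Nat.cast_sub h]
      congr 1
      ring
  have hi := (weight_pos i).ne'
  have hj := (weight_pos j).ne'
  have h1 := (weight_pos (i + j)).ne'
  have h2 := (weight_pos (i - j + (j - i))).ne'
  rw [mulBasis, map_add, map_smul, map_smul, eval_basis, eval_basis, hcos, cos_sub, Nat.cast_add,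
    add_mul, cos_add, smul_eq_mul, smul_eq_mul]
  field_simp
  ring

/-- Multiplication of cosine series, in terms of the weighted coefficients. -/
def mul : Coeff →L[ℝ] Coeff →L[ℝ] Coeff :=
  lift (fun i => lift (mulBasis i) 1 (norm_mulBasis_le i)) 1 fun _ => norm_lift_le _ _ _

theorem eval_mul (x : ℝ) (a b : Coeff) : eval x (mul a b) = eval x a * eval x b := by
  have h1 : ∀ i, eval x (lift (mulBasis i) 1 (norm_mulBasis_le i) b)
      = cos (i * x) / weight i * eval x b := fun i => by
    rw [map_lift, eval, lift_apply, ← tsum_mul_left]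
    refine tsum_congr fun j => ?_
    rw [← eval, eval_mulBasis, smul_eq_mul, smul_eq_mul]
    ring
  have h2 := map_lift (fun i => lift (mulBasis i) 1 (norm_mulBasis_le i)) 1
    (fun i => norm_lift_le _ _ _) ((eval x).comp (ContinuousLinearMap.apply ℝ Coeff b)) a
  simp only [ContinuousLinearMap.comp_apply, ContinuousLinearMap.apply_apply, h1] at h2
  have ea : eval x a = ∑' k, a k • (cos (k * x) / weight k) := rfl
  rw [mul, h2, ea, ← tsum_mul_right]
  refine tsum_congr fun j => ?_
  rw [smul_eq_mul, smul_eq_mul]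
  ring

/-! ### Realization in the Hölder space -/

/-- The weight `(1 + k)²` controls the coefficients of the first two derivatives. -/
theorem summable_of_weighted {r : ℕ → ℝ} (hr : Summable fun k => weight k * |r k|) :
    (Summable fun k => |r k|) ∧ (Summable fun k : ℕ => |k * r k|) ∧
      Summable fun k : ℕ => |k * (k * r k)| := by
  refine ⟨?_, ?_, ?_⟩ <;> refine Summable.of_nonneg_of_le (fun k => abs_nonneg _) (fun k => ?_) hr
  · refine le_mul_of_one_le_left (abs_nonneg _) ?_
    unfold weight
    nlinarith [Nat.cast_nonneg (α := ℝ) k]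
  · rw [abs_mul, Nat.abs_cast]
    refine mul_le_mul_of_nonneg_right ?_ (abs_nonneg _)
    unfold weight
    nlinarith [Nat.cast_nonneg (α := ℝ) k]
  · rw [abs_mul, abs_mul, Nat.abs_cast, ← mul_assoc]
    refine mul_le_mul_of_nonneg_right ?_ (abs_nonneg _)
    unfold weight
    nlinarith [Nat.cast_nonneg (α := ℝ) k]

theorem hasSum_weighted (b : Coeff) :
    HasSum (fun k => weight k * |b k / weight k|) ‖b‖ := by
  convert! b.hasSum_abs using 2 with k
  rw [abs_div, abs_of_pos (weight_pos k), mul_div_cancel₀ _ (weight_pos k).ne']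

/-- The projection onto the functions of zero mean. -/
def dropMean : Coeff →L[ℝ] Coeff :=
  diag (fun k => if k = 0 then 0 else 1) 1 fun k => by split_ifs <;> simp

theorem dropMean_apply (b : Coeff) (k : ℕ) : dropMean b k = if k = 0 then 0 else b k := by
  rw [dropMean, diag_apply]
  split_ifs <;> simp

theorem norm_dropMean_le (b : Coeff) : ‖dropMean b‖ ≤ ‖b‖ := by
  refine hasSum_le (fun k => ?_) (hasSum_abs _) b.hasSum_abs
  rw [dropMean_apply]
  split_ifs <;> simp

/-- A bounded function with bounded derivative satisfies every Hölder condition. -/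
theorem holder_of_bounds {g g' : ℝ → ℝ} {A s : ℝ} (hs0 : 0 ≤ s) (hs1 : s ≤ 1)
    (hg : ∀ x, HasDerivAt g (g' x) x) (h0 : ∀ x, |g x| ≤ A) (h1 : ∀ x, |g' x| ≤ A) (x y : ℝ) :
    |g x - g y| ≤ 2 * A * |x - y| ^ s := by
  have hA : 0 ≤ A := (abs_nonneg _).trans (h0 0)
  rcases le_total 1 |x - y| with h | h
  · have h2 : |g x - g y| ≤ 2 * A := by
      refine (abs_sub _ _).trans ?_
      linarith [h0 x, h0 y]
    exact h2.trans (le_mul_of_one_le_right (by positivity) (one_le_rpow h hs0))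
  · have h2 : |g x - g y| ≤ A * |x - y| :=
      convex_univ.norm_image_sub_le_of_norm_hasDerivWithin_le
        (fun z _ => (hg z).hasDerivWithinAt) (fun z _ => h1 z) (mem_univ y) (mem_univ x)
    have h3 : |x - y| ≤ |x - y| ^ s := by
      rcases eq_or_lt_of_le (abs_nonneg (x - y)) with h4 | h4
      · rw [← h4]
        exact rpow_nonneg le_rfl _
      · nth_rw 1 [← rpow_one |x - y|]
        exact rpow_le_rpow_of_exponent_ge h4 h hs1
    have := mul_le_mul_of_nonneg_left h3 hA
    have := mul_nonneg hA (rpow_nonneg (abs_nonneg (x - y)) s)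
    linarith

/-- The function represented by `b ∈ ℓ¹` is twice differentiable, and it and its derivatives are
bounded by the norm of `b`. -/
theorem eval_regular (b : Coeff) :
    (∀ x, HasDerivAt (fun x => eval x b) (-sinSeries (fun k => k * (b k / weight k)) x) x) ∧
    (∀ x, HasDerivAt (fun x => -sinSeries (fun k => k * (b k / weight k)) x)
      (-cosSeries (fun k => k * (k * (b k / weight k))) x) x) ∧
    (∀ x, |eval x b| ≤ ‖b‖) ∧ (∀ x, |-sinSeries (fun k => k * (b k / weight k)) x| ≤ ‖b‖) ∧
    (∀ x, |-cosSeries (fun k => k * (k * (b k / weight k))) x| ≤ ‖b‖) := by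
  obtain ⟨s0, s1, s2⟩ := summable_of_weighted b.hasSum_weighted.summable
  have hle : ∀ k : ℕ, |(k : ℝ)| ≤ weight k ∧ |(k : ℝ)| * |(k : ℝ)| ≤ weight k := fun k => by
    rw [Nat.abs_cast]
    unfold weight
    constructor <;> nlinarith [Nat.cast_nonneg (α := ℝ) k]
  refine ⟨fun x => ?_, fun x => (hasDerivAt_sinSeries s1 s2 x).fun_neg, fun x => ?_, fun x => ?_,
    fun x => ?_⟩
  · simp only [eval_eq_cosSeries]
    exact hasDerivAt_cosSeries s0 s1 x
  · have := (eval x).le_of_opNorm_le (norm_lift_le _ _ (norm_eval_le x)) b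
    rwa [one_mul] at this
  · rw [abs_neg]
    refine (abs_sinSeries_le s1 x).trans (hasSum_le (fun k => ?_) s1.hasSum b.hasSum_weighted)
    rw [abs_mul]
    exact mul_le_mul_of_nonneg_right (hle k).1 (abs_nonneg _)
  · rw [abs_neg]
    refine (abs_cosSeries_le s2 x).trans (hasSum_le (fun k => ?_) s2.hasSum b.hasSum_weighted)
    rw [abs_mul, abs_mul, ← mul_assoc]
    exact mul_le_mul_of_nonneg_right (hle k).2 (abs_nonneg _)

theorem holder_eval {a : ℝ} (ha1 : 1 < a) (ha2 : a < 2) (b : Coeff) (x y : ℝ) :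
    |deriv (fun x => eval x b) x - deriv (fun x => eval x b) y|
      ≤ 2 * ‖b‖ * |x - y| ^ (a - 1) := by
  obtain ⟨h1, h2, -, h4, h5⟩ := b.eval_regular
  rw [(h1 x).deriv, (h1 y).deriv]
  exact holder_of_bounds (by linarith) (by linarith) h2 h4 h5 x y

theorem eval_dropMean_mem {a : ℝ} (ha1 : 1 < a) (ha2 : a < 2) (b : Coeff) :
    (fun x => eval x (dropMean b)) ∈ evenHolderSubmodule a := by
  obtain ⟨h1, h2, -, -, -⟩ := (dropMean b).eval_regular
  obtain ⟨s0, -, -⟩ := summable_of_weighted (dropMean b).hasSum_weighted.summable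
  have e : (fun x => eval x (dropMean b)) = cosSeries fun k => dropMean b k / weight k :=
    funext fun x => eval_eq_cosSeries x _
  refine ⟨?_, fun x => ?_, ?_, ?_, 2 * ‖dropMean b‖, holder_eval ha1 ha2 _⟩
  · rw [e]
    exact periodic_cosSeries _
  · simp only [eval_eq_cosSeries, cosSeries_neg]
  · simp only [eval_eq_cosSeries]
    exact integral_cosSeries s0 (by simp [dropMean_apply])
  · rw [contDiff_one_iff_deriv]
    refine ⟨fun x => (h1 x).differentiableAt, ?_⟩
    rw [funext fun x => (h1 x).deriv]
    exact continuous_iff_continuousAt.2 fun x => (h2 x).continuousAt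

/-- The continuous embedding of the space of coefficients, without the mean, into
`C^a_{0,even}(𝕋)`. -/
def toHolder {a : ℝ} (ha1 : 1 < a) (ha2 : a < 2) : Coeff →L[ℝ] EvenHolder a :=
  LinearMap.mkContinuous
    { toFun := fun b =>
        (⟨fun x => eval x (dropMean b), eval_dropMean_mem ha1 ha2 b⟩ : evenHolderSubmodule a)
      map_add' := fun b b' => Subtype.ext (funext fun x => by simp; rfl)
      map_smul' := fun r b => Subtype.ext (funext fun x => by simp; rfl) }
    4 fun b => by
      obtain ⟨h1, -, h3, h4, -⟩ := (dropMean b).eval_regular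
      have hb := norm_dropMean_le b
      rw [EvenHolder.norm_def]
      have i1 : (⨆ x : ℝ, |eval x (dropMean b)|) ≤ ‖b‖ := ciSup_le fun x => (h3 x).trans hb
      have i2 : (⨆ x : ℝ, |deriv (fun x => eval x (dropMean b)) x|) ≤ ‖b‖ := ciSup_le fun x => by
        rw [(h1 x).deriv]
        exact (h4 x).trans hb
      have i3 : (⨆ p : ℝ × ℝ, |(deriv (fun x => eval x (dropMean b)) p.1
          - deriv (fun x => eval x (dropMean b)) p.2) / |p.1 - p.2| ^ (a - 1)|) ≤ 2 * ‖b‖ := by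
        refine ciSup_le fun p => ?_
        rw [abs_div, abs_of_nonneg (rpow_nonneg (abs_nonneg (p.1 - p.2)) (a - 1))]
        refine div_le_of_le_mul₀ (rpow_nonneg (abs_nonneg _) _) (by positivity) ?_
        refine (holder_eval ha1 ha2 _ _ _).trans ?_
        gcongr
      exact (add_le_add (add_le_add i1 i2) i3).trans (by linarith)

theorem toFun_toHolder {a : ℝ} (ha1 : 1 < a) (ha2 : a < 2) (b : Coeff) :
    (toHolder ha1 ha2 b).toFun = fun x => eval x (dropMean b) := rfl

end Coeff

/-! ### The bifurcation equation -/

/-- The symbol of the linearization at the speed `1 - β`; it vanishes at `k = 1`. -/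
def symbol (β : ℝ) (k : ℕ) : ℝ := -(1 - β) - β * k ^ 2 + ((k : ℝ) ^ 2)⁻¹

theorem symbol_le {β : ℝ} (hβ : 0 ≤ β) {k : ℕ} (hk : 2 ≤ k) : symbol β k ≤ -(3 / 4) := by
  have hk' : (4 : ℝ) ≤ (k : ℝ) ^ 2 := by
    have : (2 : ℝ) ≤ k := by exact_mod_cast hk
    nlinarith
  have h1 : ((k : ℝ) ^ 2)⁻¹ ≤ 4⁻¹ := inv_anti₀ (by norm_num) hk'
  have h2 := mul_le_mul_of_nonneg_left hk' hβ
  unfold symbol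
  linarith

/-- The inverse of the symbol off the kernel of the linearization. -/
def invSymbol (β : ℝ) (k : ℕ) : ℝ := if k < 2 then 0 else (symbol β k)⁻¹

theorem abs_invSymbol_le {β : ℝ} (hβ : 0 ≤ β) (k : ℕ) : |invSymbol β k| ≤ 4 / 3 := by
  unfold invSymbol
  split_ifs with hk
  · norm_num
  · have := symbol_le hβ (not_lt.1 hk)
    rw [abs_inv, abs_of_neg (by linarith)]
    exact inv_le_of_inv_le₀ (by norm_num) (by norm_num; linarith)

namespace Coeff

/-- The inverse of the linearization on the modes `k ≥ 2`. -/
def invLin {β : ℝ} (hβ : 0 ≤ β) : Coeff →L[ℝ] Coeff :=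
  diag (invSymbol β) (4 / 3) (abs_invSymbol_le hβ)

/-- The rescaled profile `u = φ / ε`, with the weighted coefficient of the first mode normalized to
`1`. -/
def profile {β : ℝ} (hβ : 0 ≤ β) (y : Coeff) : Coeff := basis 1 + invLin hβ y

/-- The rescaled nonlinearity `ε⁻² (σ/2 φ² + α/3 φ³)` for `φ = ε u`. -/
def nonlin (σ α ε : ℝ) (u : Coeff) : Coeff :=
  (σ / 2) • mul u u + (ε * (α / 3)) • mul u (mul u u)

/-- The bifurcation equation is `residual = 0`. For the profile `φ = ε u` at the speed
`1 - β - y 1`, where `u` is `cos x / 4` plus the inverse of the linearization applied to `y`, the steady equation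
divided by `ε` takes this form: the speed is determined by the first mode, and the constant of
integration by the mode `0`. -/
def residual (σ α : ℝ) {β : ℝ} (hβ : 0 ≤ β) (p : ℝ × Coeff) : Coeff :=
  p.2 + coord 1 p.2 • invLin hβ p.2 + p.1 • nonlin σ α p.1 (profile hβ p.2)

variable {σ α β : ℝ}

theorem contDiff_profile (hβ : 0 ≤ β) {n : WithTop ℕ∞} : ContDiff ℝ n (profile hβ) :=
  contDiff_const.add (invLin hβ).contDiff

theorem contDiff_residual (hβ : 0 ≤ β) {n : WithTop ℕ∞} : ContDiff ℝ n (residual σ α hβ) := by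
  have hu : ContDiff ℝ n fun p : ℝ × Coeff => profile hβ p.2 :=
    (contDiff_profile hβ).comp contDiff_snd
  have huu : ContDiff ℝ n fun p : ℝ × Coeff => mul (profile hβ p.2) (profile hβ p.2) :=
    (mul.contDiff.comp hu).clm_apply hu
  have huuu : ContDiff ℝ n fun p : ℝ × Coeff =>
      mul (profile hβ p.2) (mul (profile hβ p.2) (profile hβ p.2)) :=
    (mul.contDiff.comp hu).clm_apply huu
  have hN : ContDiff ℝ n fun p : ℝ × Coeff => nonlin σ α p.1 (profile hβ p.2) :=
    (huu.const_smul (σ / 2)).add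
      ((contDiff_fst.mul (contDiff_const (c := α / 3))).smul huuu)
  exact (contDiff_snd.add (((coord 1).contDiff.comp contDiff_snd).smul
    ((invLin hβ).contDiff.comp contDiff_snd))).add (contDiff_fst.smul hN)

theorem residual_zero (hβ : 0 ≤ β) : residual σ α hβ (0, 0) = 0 := by simp [residual]

/-- The derivative of the bifurcation equation in `y` at the origin is the identity. -/
theorem fderiv_residual_comp_inr (hβ : 0 ≤ β) :
    (fderiv ℝ (residual σ α hβ) (0, 0)).comp (ContinuousLinearMap.inr ℝ ℝ Coeff)
      = ContinuousLinearMap.id ℝ Coeff := by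
  have h1 : HasFDerivAt (fun y : Coeff => residual σ α hβ (0, y))
      ((fderiv ℝ (residual σ α hβ) (0, 0)).comp (ContinuousLinearMap.inr ℝ ℝ Coeff)) 0 :=
    HasFDerivAt.comp (g := residual σ α hβ) (0 : Coeff)
      (((contDiff_residual hβ (n := 1)).differentiable one_ne_zero _).hasFDerivAt)
      (hasFDerivAt_prodMk_right (0 : ℝ) (0 : Coeff))
  have h2 : HasFDerivAt (fun y : Coeff => residual σ α hβ (0, y))
      (ContinuousLinearMap.id ℝ Coeff + (coord 1 (0 : Coeff) • invLin hβ
        + (coord 1).smulRight (invLin hβ 0))) 0 := by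
    simp only [residual, zero_smul, add_zero]
    exact (hasFDerivAt_id _).add ((coord 1).hasFDerivAt.smul (invLin hβ).hasFDerivAt)
  rw [h1.unique h2]
  simp

/-- The implicit function theorem for the bifurcation equation. -/
theorem exists_branch (hβ : 0 ≤ β) : ∃ y : ℝ → Coeff, y 0 = 0 ∧
    (∀ᶠ ε in 𝓝 0, residual σ α hβ (ε, y ε) = 0) ∧ ∀ᶠ ε in 𝓝 0, ContDiffAt ℝ ∞ y ε := by
  have hcd : ContDiffAt ℝ ω (residual σ α hβ) (0, 0) := (contDiff_residual hβ).contDiffAt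
  have hinv : ((fderiv ℝ (residual σ α hβ) (0, 0)).comp
      (ContinuousLinearMap.inr ℝ ℝ Coeff)).IsInvertible := by
    rw [fderiv_residual_comp_inr]
    exact ⟨ContinuousLinearEquiv.refl ℝ Coeff, rfl⟩
  have hω : (ω : WithTop ℕ∞) ≠ 0 := by simp
  refine ⟨hcd.implicitFunction hω hinv, hcd.implicitFunction_apply_self hω hinv, ?_, ?_⟩
  · filter_upwards [hcd.eventually_apply_implicitFunction hω hinv] with ε hε
    rw [hε, residual_zero]
  · filter_upwards [(hcd.contDiffAt_implicitFunction hω hinv).eventually (by simp)] with ε hε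
    exact hε.of_le le_top

theorem profile_apply (hβ : 0 ≤ β) (y : Coeff) (k : ℕ) :
    profile hβ y k = (if k = 1 then 1 else 0) + invSymbol β k * y k := by
  rw [profile, lp.coeFn_add, Pi.add_apply, basis_apply, invLin, diag_apply]

theorem dropMean_smul_profile (hβ : 0 ≤ β) (ε : ℝ) (y : Coeff) :
    dropMean (ε • profile hβ y) = ε • profile hβ y := by
  refine lp.ext (funext fun k => ?_)
  rw [dropMean_apply]
  split_ifs with hk
  · rw [hk, lp.coeFn_smul, Pi.smul_apply, profile_apply]
    simp [invSymbol]
  · rfl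

/-- Zeros of the bifurcation equation are solutions of the steady equation. -/
theorem isSolution_of_residual_eq_zero (hβ : 0 ≤ β) {ε : ℝ} {y : Coeff}
    (hy : residual σ α hβ (ε, y) = 0) :
    IsSolution (1 - β - y 1) β σ α fun x => eval x (ε • profile hβ y) := by
  set u := profile hβ y with hu
  set r : ℕ → ℝ := fun k => (ε • u) k / weight k with hr
  have hu0 : u 0 = 0 := by simp [hu, profile_apply, invSymbol]
  have hrk : ∀ k, r k = ε * u k / weight k := fun k => rfl
  have hr0 : r 0 = 0 := by rw [hrk, hu0, mul_zero, zero_div]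
  obtain ⟨s0, s1, s2⟩ := summable_of_weighted (ε • u).hasSum_weighted.summable
  obtain ⟨d1, d2, -⟩ := (ε • u).eval_regular
  have e : (fun x => eval x (ε • u)) = cosSeries r := funext fun x => eval_eq_cosSeries x _
  rw [e] at d1 ⊢
  have cφ : Continuous (cosSeries r) := continuous_cosSeries s0
  -- The potential `V = D⁻² φ` is the cosine series with coefficients `r k / k²`.
  set q : ℕ → ℝ := fun k => r k / k with hq
  set p : ℕ → ℝ := fun k => q k / k with hp
  have div_le : ∀ (b : ℕ → ℝ) (k : ℕ), |b k / k| ≤ |b k| := fun b k => by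
    rw [abs_div, Nat.abs_cast]
    rcases Nat.eq_zero_or_pos k with rfl | hk
    · simp
    · exact div_le_self (abs_nonneg _) (by exact_mod_cast hk)
  have sq : Summable fun k => |q k| :=
    Summable.of_nonneg_of_le (fun k => abs_nonneg _) (div_le r) s0
  have sp : Summable fun k => |p k| :=
    Summable.of_nonneg_of_le (fun k => abs_nonneg _) (div_le q) sq
  have hqr : (fun k : ℕ => k * q k) = r := funext fun k => by
    rcases Nat.eq_zero_or_pos k with rfl | hk
    · simp [hr0]
    · have : (k : ℝ) ≠ 0 := by exact_mod_cast hk.ne'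
      simp only [hq]
      field_simp
  have hpq : (fun k : ℕ => k * p k) = q := funext fun k => by
    rcases Nat.eq_zero_or_pos k with rfl | hk
    · simp [hq]
    · have : (k : ℝ) ≠ 0 := by exact_mod_cast hk.ne'
      simp only [hp]
      field_simp
  have dV : ∀ x, HasDerivAt (cosSeries p) (-sinSeries q x) x := fun x => by
    have := hasDerivAt_cosSeries sp (by simpa only [funext_iff.1 hpq] using sq) x
    rwa [hpq] at this
  have dV' : ∀ x, HasDerivAt (fun x => -sinSeries q x) (-cosSeries r x) x := fun x => by
    have := (hasDerivAt_sinSeries sq (by simpa only [funext_iff.1 hqr] using s0) x).fun_neg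
    rwa [hqr] at this
  have hV : ∀ x, invDSq (cosSeries r) x = cosSeries p x :=
    invDSq_eq cφ dV dV' (periodic_cosSeries p)
      (fun x => by simp only [periodic_sinSeries q x]) (integral_cosSeries sp (by simp [hp]))
  have coords : ∀ k, y k + y 1 * (invSymbol β k * y k) + ε * nonlin σ α ε u k = 0 := fun k => by
    have := congrArg (coord k) hy
    rw [residual, map_add, map_add, map_smul, map_smul, map_zero] at this
    rw [← diag_apply (invSymbol β) (4 / 3) (abs_invSymbol_le hβ)]
    exact this
  have hF : ∀ x, F (1 - β - y 1) σ α (cosSeries r x)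
      = -(1 - β - y 1) * cosSeries r x + ε * eval x (ε • nonlin σ α ε u) := fun x => by
    rw [← congrFun e x]
    simp only [F, nonlin, map_add, map_smul, smul_eq_mul, eval_mul]
    ring
  -- The equation holds mode by mode; only the mode `0` remains, which gives the constant.
  have key : ∀ x, F (1 - β - y 1) σ α (cosSeries r x)
      + β * -cosSeries (fun k => k * (k * r k)) x + cosSeries p x = -ε * y 0 := fun x => by
    obtain ⟨sN, -, -⟩ := summable_of_weighted (ε • nonlin σ α ε u).hasSum_weighted.summable
    have h1 := (((hasSum_cosSeries s0 x).mul_left (-(1 - β - y 1))).add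
      ((hasSum_cosSeries sN x).mul_left ε)).add
      (((hasSum_cosSeries s2 x).neg.mul_left β).add (hasSum_cosSeries sp x))
    rw [← eval_eq_cosSeries x (ε • nonlin σ α ε u)] at h1
    rw [hF, add_assoc]
    refine h1.unique ?_
    have hz := coords 0
    have hterm : ∀ k : ℕ, -(1 - β - y 1) * (r k * cos (k * x))
        + ε * ((ε • nonlin σ α ε u) k / weight k * cos (k * x))
        + (β * -(k * (k * r k) * cos (k * x)) + p k * cos (k * x))
        = ε / weight k * cos (k * x) *
          ((symbol β k + y 1) * u k + ε * nonlin σ α ε u k) := fun k => by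
      rw [lp.coeFn_smul, Pi.smul_apply, smul_eq_mul, symbol]
      simp only [hp, hq, hrk, div_eq_mul_inv]
      ring
    have hterm0 : ∀ k : ℕ, k ≠ 0 → (symbol β k + y 1) * u k + ε * nonlin σ α ε u k = 0 := by
      intro k hk
      have hN := coords k
      rw [hu, profile_apply]
      rcases eq_or_ne k 1 with rfl | hk1
      · simp [invSymbol, symbol] at hN ⊢
        linarith
      · have hk2 : ¬ k < 2 := by omega
        have hs : symbol β k ≠ 0 := by
          have := symbol_le hβ (not_lt.1 hk2)
          linarith
        have hinv : symbol β k * invSymbol β k = 1 := by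
          rw [invSymbol, if_neg hk2, mul_inv_cancel₀ hs]
        rw [if_neg hk1]
        linear_combination hN + y k * hinv
    have hval : ε / weight 0 * cos ((0 : ℕ) * x) *
        ((symbol β 0 + y 1) * u 0 + ε * nonlin σ α ε u 0) = -ε * y 0 := by
      simp only [invSymbol, Nat.ofNat_pos, if_true, zero_mul, mul_zero, add_zero] at hz
      rw [hu0, weight, Nat.cast_zero, zero_mul, cos_zero]
      linear_combination ε * hz
    have h2 := hasSum_single (f := fun k : ℕ => ε / weight k * cos (k * x) *
      ((symbol β k + y 1) * u k + ε * nonlin σ α ε u k)) 0 fun k hk => by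
        rw [hterm0 k hk, mul_zero]
    rw [← funext hterm] at h2
    simp only at h2
    rw [hval] at h2
    exact h2
  have cφ2 : Continuous fun x => -cosSeries (fun k => k * (k * r k)) x :=
    (continuous_cosSeries s2).neg
  have pφ' : Function.Periodic (fun x => -sinSeries (fun k => k * r k) x) (2 * π) := fun x => by
    simp only [periodic_sinSeries _ x]
  refine ⟨cφ, periodic_cosSeries r, integral_cosSeries s0 hr0, -ε * y 0, fun ψ hψ pψ => ?_⟩
  have cψ := hψ.continuous
  have cψ2 : Continuous (iteratedDeriv 2 ψ) := hψ.continuous_iteratedDeriv 2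
    (WithTop.coe_le_coe.2 le_top)
  have cF : Continuous fun x => F (1 - β - y 1) σ α (cosSeries r x) := (continuous_F _ _ _).comp cφ
  have parts := integral_deriv_deriv_mul d1 d2 cφ2 (periodic_cosSeries r) pφ' hψ pψ
  rw [intervalIntegral.integral_add (Continuous.intervalIntegrable (by fun_prop) _ _)
    (Continuous.intervalIntegrable (by fun_prop) _ _), intervalIntegral.integral_const_mul, ← parts,
    ← intervalIntegral.integral_const_mul,
    ← intervalIntegral.integral_add (Continuous.intervalIntegrable (by fun_prop) _ _)
    (Continuous.intervalIntegrable (by fun_prop) _ _)]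
  refine intervalIntegral.integral_congr fun x _ => ?_
  simp only [hV]
  linear_combination ψ x * key x

end Coeff

/-- The bifurcation curve: smooth families of solutions emanating from `φ = 0` at the speed
`1 - β`. -/
theorem exists_bifurcation_curve (σ α : ℝ) {β : ℝ} (hβ : 0 ≤ β) (hβ1 : β < 1) {a : ℝ}
    (ha1 : 1 < a) (ha2 : a < 2) :
    ∃ ε₀ : ℝ, 0 < ε₀ ∧ ∃ (c : ℝ → ℝ) (Φ : ℝ → EvenHolder a),
      ContDiffOn ℝ ∞ c (Ioo (-ε₀) ε₀) ∧ ContDiffOn ℝ ∞ Φ (Ioo (-ε₀) ε₀) ∧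
      c 0 = 1 - β ∧ Φ 0 = 0 ∧ deriv Φ 0 ≠ 0 ∧
      ∀ ε ∈ Ioo (-ε₀) ε₀, 0 < c ε ∧
        IsSolution (c ε) β σ α (Φ ε).toFun ∧ (ε ≠ 0 → Φ ε ≠ 0) := by
  obtain ⟨y, hy0, hbif, hsmooth⟩ := Coeff.exists_branch (σ := σ) (α := α) hβ
  let c : ℝ → ℝ := fun ε => 1 - β - Coeff.coord 1 (y ε)
  let Φ : ℝ → EvenHolder a := fun ε =>
    Coeff.toHolder ha1 ha2 (ε • Coeff.profile hβ (y ε))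
  have hc0 : c 0 = 1 - β := by simp [c, hy0]
  have hΦ0 : Φ 0 = 0 := by simp [Φ]
  have hcs : ∀ ε, ContDiffAt ℝ ∞ y ε → ContDiffAt ℝ ∞ c ε := fun ε h =>
    contDiffAt_const.sub ((Coeff.coord 1).contDiff.contDiffAt.comp ε h)
  have hu : ∀ ε, ContDiffAt ℝ ∞ y ε → ContDiffAt ℝ ∞ (fun ε => Coeff.profile hβ (y ε)) ε :=
    fun ε h => (Coeff.contDiff_profile hβ).contDiffAt.comp ε h
  have hΦs : ∀ ε, ContDiffAt ℝ ∞ y ε → ContDiffAt ℝ ∞ Φ ε := fun ε h =>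
    (Coeff.toHolder ha1 ha2).contDiff.contDiffAt.comp ε (contDiffAt_id.smul (hu ε h))
  have hd : HasDerivAt Φ (Coeff.toHolder ha1 ha2 (Coeff.basis 1)) 0 := by
    have h1 := (hu 0 hsmooth.self_of_nhds).differentiableAt (by simp)
    have h2 := (hasDerivAt_id (0 : ℝ)).smul h1.hasDerivAt
    have h3 := (Coeff.toHolder ha1 ha2).hasFDerivAt.comp_hasDerivAt (0 : ℝ) h2
    refine h3.congr_deriv ?_
    simp [hy0, Coeff.profile]
  have hne : Coeff.toHolder ha1 ha2 (Coeff.basis 1) ≠ 0 := by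
    intro h
    have h1 : Coeff.dropMean (Coeff.basis 1) = Coeff.basis 1 := by
      refine lp.ext (funext fun k => ?_)
      rw [Coeff.dropMean_apply, Coeff.basis_apply]
      split_ifs <;> simp_all
    have h2 : (Coeff.toHolder ha1 ha2 (Coeff.basis 1)).toFun 0 = 0 := by
      rw [h]
      rfl
    rw [Coeff.toFun_toHolder, h1] at h2
    simp only [Coeff.eval_basis, mul_zero, cos_zero] at h2
    exact (one_div_pos.2 (weight_pos 1)).ne' h2
  have hpos : ∀ᶠ ε in 𝓝 0, 0 < c ε :=
    (hcs 0 hsmooth.self_of_nhds).continuousAt.eventually_const_lt (by rw [hc0]; linarith)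
  have hΦne : ∀ᶠ ε in 𝓝 (0 : ℝ), ε ≠ 0 → Φ ε ≠ 0 :=
    eventually_nhdsWithin_iff.1 (hd.eventually_ne hne)
  obtain ⟨ε₀, hε₀, hball⟩ := Metric.eventually_nhds_iff_ball.1
    (hbif.and (hsmooth.and (hpos.and hΦne)))
  rw [Real.ball_eq_Ioo, zero_sub, zero_add] at hball
  refine ⟨ε₀, hε₀, c, Φ, fun ε hε => (hcs ε (hball ε hε).2.1).contDiffWithinAt,
    fun ε hε => (hΦs ε (hball ε hε).2.1).contDiffWithinAt, hc0, hΦ0, ?_, fun ε hε => ?_⟩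
  · rw [hd.deriv]
    exact hne
  · obtain ⟨h1, -, h3, h4⟩ := hball ε hε
    refine ⟨h3, ?_, h4⟩
    have := Coeff.isSolution_of_residual_eq_zero hβ h1
    rw [Coeff.toFun_toHolder, Coeff.dropMean_smul_profile]
    exact this

end

end GardnerOstrovsky

theorem mainTheorem7 (σ α : ℝ) :
    -- existence: the bifurcation curve
    (∀ β : ℝ, 0 ≤ β → β < 1 → ∀ a : ℝ, 1 < a → a < 2 →
      ∃ ε₀ : ℝ, 0 < ε₀ ∧ ∃ (c : ℝ → ℝ) (Φ : ℝ → GardnerOstrovsky.EvenHolder a),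
        ContDiffOn ℝ ∞ c (Ioo (-ε₀) ε₀) ∧ ContDiffOn ℝ ∞ Φ (Ioo (-ε₀) ε₀) ∧
        c 0 = 1 - β ∧ Φ 0 = 0 ∧ deriv Φ 0 ≠ 0 ∧
        ∀ ε ∈ Ioo (-ε₀) ε₀, 0 < c ε ∧
          GardnerOstrovsky.IsSolution (c ε) β σ α (Φ ε).toFun ∧ (ε ≠ 0 → Φ ε ≠ 0)) ∧
    -- non-zero Boussinesq dispersion
    (∀ c β : ℝ, 0 < c → 0 < β → ∀ φ : ℝ → ℝ, GardnerOstrovsky.IsSolution c β σ α φ →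
      ContDiff ℝ ∞ φ ∧
      (GardnerOstrovsky.SingleCrest φ → GardnerOstrovsky.Symmetric φ)) ∧
    -- zero Boussinesq dispersion
    (∀ c : ℝ, 0 < c → ∀ φ : ℝ → ℝ, GardnerOstrovsky.IsSolution c 0 σ α φ →
      (∀ U : Set ℝ, IsOpen U → (∀ x ∈ U, σ * φ x + α * φ x ^ 2 < c) → ContDiffOn ℝ ∞ φ U) ∧
      (α < -(σ ^ 2 / (4 * c)) → ContDiff ℝ ∞ φ) ∧
      (∀ x₀ : ℝ, IsLocalExtr φ x₀ → σ * φ x₀ + α * φ x₀ ^ 2 = c → ¬ ContDiff ℝ 1 φ) ∧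
      (∀ x₀ : ℝ, GardnerOstrovsky.AttainsCritical c σ α φ x₀ →
        ¬ ContDiff ℝ 1 φ ∧
        (-(σ ^ 2 / (4 * c)) < α →
          GardnerOstrovsky.PreciselyHolderAt 1 φ x₀ ∧
          ∃ dL dR : ℝ,
            HasDerivWithinAt φ dL (Iio x₀) x₀ ∧ Tendsto (deriv φ) (𝓝[<] x₀) (𝓝 dL) ∧
            HasDerivWithinAt φ dR (Ioi x₀) x₀ ∧ Tendsto (deriv φ) (𝓝[>] x₀) (𝓝 dR) ∧
            |dL| ^ 2 = |φ x₀| / |σ + 2 * α * φ x₀| ∧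
            |dR| ^ 2 = |φ x₀| / |σ + 2 * α * φ x₀|) ∧
        (α = -(σ ^ 2 / (4 * c)) →
          GardnerOstrovsky.PreciselyHolderAt (2 / 3) φ x₀ ∧
          Tendsto (fun x => |φ x - φ x₀| / |x - x₀| ^ (2 / 3 : ℝ)) (𝓝[≠] x₀)
            (𝓝 ((3 * |φ x₀| / (2 * |α|)) ^ (1 / 3 : ℝ))))) ∧
      -- amplitude bounds
      (0 < α → ∀ x y : ℝ, φ x - φ y ≤ 2 * √(σ ^ 2 / (4 * α ^ 2) + c / α)) ∧
      (-(σ ^ 2 / (4 * c)) < α → α < 0 → 0 < σ →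
        0 < GardnerOstrovsky.critMinus c σ α ∧ ∀ x, φ x ≤ GardnerOstrovsky.critMinus c σ α) ∧
      (-(σ ^ 2 / (4 * c)) < α → α < 0 → σ < 0 →
        GardnerOstrovsky.critPlus c σ α < 0 ∧ ∀ x, GardnerOstrovsky.critPlus c σ α ≤ φ x) ∧
      (α = 0 → 0 < σ →
        0 < GardnerOstrovsky.critZero c σ ∧ ∀ x, φ x ≤ GardnerOstrovsky.critZero c σ) ∧
      (α = 0 → σ < 0 →
        GardnerOstrovsky.critZero c σ < 0 ∧ ∀ x, GardnerOstrovsky.critZero c σ ≤ φ x)) := by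
  open GardnerOstrovsky in
  refine ⟨fun β hβ hβ1 a ha1 ha2 => exists_bifurcation_curve σ α hβ hβ1 ha1 ha2,
    fun c β hc hβ φ hφ => ?_, fun c hc φ hφ => ?_⟩
  · obtain ⟨B, φ', v, v', hw⟩ := hφ.exists_isWave hβ.ne'
    exact ⟨hw.contDiff, hw.symmetric_of_singleCrest hβ⟩
  obtain ⟨w', hw, hw'⟩ := hφ.exists_deriv_F
  have hcont := hφ.continuous
  have hsmooth : ∀ U : Set ℝ, IsOpen U → (∀ x ∈ U, σ * φ x + α * φ x ^ 2 < c) →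
      ContDiffOn ℝ ∞ φ U := fun U hU h =>
    contDiffOn_of_noncritical hcont hw hw' hU fun x hx => by linarith [h x hx]
  have hcorner : ∀ x₀ : ℝ, IsLocalExtr φ x₀ → σ * φ x₀ + α * φ x₀ ^ 2 = c → ¬ ContDiff ℝ 1 φ :=
    fun x₀ hx hs hC => not_differentiableAt_of_critical hc hw hw' hx hs
      (hC.differentiable one_ne_zero x₀)
  refine ⟨hsmooth, fun hα => ?_, hcorner, fun x₀ hx₀ => ?_, fun hα x y => ?_,
    fun h1 hα hσ => ?_, fun h1 hα hσ => ?_, fun hα hσ => ?_, fun hα hσ => ?_⟩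
  · refine contDiffOn_univ.1 (hsmooth univ isOpen_univ fun x _ => ?_)
    have hα0 : α < 0 := hα.trans_le (neg_nonpos.2 (by positivity))
    have hdisc : σ ^ 2 < -α * (4 * c) := (div_lt_iff₀ (by positivity)).1 (by linarith)
    -- Here `F'` has no zero, since `-4 α (σ s + α s²) = σ² - (σ + 2 α s)²`.
    nlinarith [sq_nonneg (σ + 2 * α * φ x)]
  · obtain ⟨⟨τ, hτ, hext⟩, hs, hnondeg, hdeg⟩ := hx₀.data hc
    refine ⟨hcorner x₀ ?_ hs,
      fun hα => corner_of_nondegenerate hc hcont hw hw' hτ hext hs (hnondeg hα),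
      fun hα => cusp_of_degenerate hc hw hw' hτ hext hs (hdeg hα).1 (hdeg hα).2⟩
    rcases hτ with rfl | rfl
    · exact Or.inr (Eventually.of_forall fun x => by linarith [hext x])
    · exact Or.inl (Eventually.of_forall fun x => by linarith [hext x])
  · have hd := disc_pos (σ := σ) hc hα.ne' (neg_sq_div_lt_of_pos hc hα)
    have hp := critPlus_sq hd.le
    have hm := critMinus_sq hd.le
    have h1 := hφ.le_of_critical (critPlus_pos hc hα) (critical_of_sq hα.ne' hp)
      (nondegenerate_of_sq hα.ne' hp hd.ne') x
    have h2 := hφ.ge_of_critical (critMinus_neg hc hα) (critical_of_sq hα.ne' hm)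
      (nondegenerate_of_sq hα.ne' hm hd.ne') y
    unfold critPlus at h1
    unfold critMinus at h2
    linarith
  · have hd := disc_pos hc hα.ne h1
    have hm := critMinus_sq hd.le
    exact ⟨critMinus_pos hc hα hσ, hφ.le_of_critical (critMinus_pos hc hα hσ)
      (critical_of_sq hα.ne hm) (nondegenerate_of_sq hα.ne hm hd.ne')⟩
  · have hd := disc_pos hc hα.ne h1
    have hp := critPlus_sq hd.le
    exact ⟨critPlus_neg hc hα hσ, hφ.ge_of_critical (critPlus_neg hc hα hσ)
      (critical_of_sq hα.ne hp) (nondegenerate_of_sq hα.ne hp hd.ne')⟩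
  · have hpos : 0 < critZero c σ := div_pos hc hσ
    have hs : σ * critZero c σ + α * critZero c σ ^ 2 = c := by
      rw [hα, critZero, zero_mul, add_zero, mul_div_cancel₀ _ hσ.ne']
    exact ⟨hpos, hφ.le_of_critical hpos hs (by simp [hα, hσ.ne'])⟩
  · have hneg : critZero c σ < 0 := div_neg_of_pos_of_neg hc hσ
    have hs : σ * critZero c σ + α * critZero c σ ^ 2 = c := by
      rw [hα, critZero, zero_mul, add_zero, mul_div_cancel₀ _ hσ.ne]
    exact ⟨hneg, hφ.ge_of_critical hneg hs (by simp [hα, hσ.ne])⟩
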